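/- **Setting.** Let $\mathbb T=[-\pi,\pi)$ be the circle with normalized Lebesgue measure $\mu$. Functions on $\mathbb T$ are complex-valued, $2\pi$-periodic, finite and defined at every point. Let $X=X(\mathbb T)$ be a Banach function lattice, that is, a complete normed space of measurable functions on $\mathbb T$ (inequalities between functions, and the vanishing of functions of norm $0$, being understood almost everywhere) such that 1. if $f$ is measurable, $g\in X$ and $|f|\le|g|$, then $f\in X$ and $\|f\|_X\le\|g\|_X$; 2. if $f_k\in X$, $\sup_k\|f_k\|_X<\infty$ and $0\le f_k\uparrow f$, then $f\in X$ and $\|f_k\|_X\to\|f\|_X$; 3. for every measurable $E\subset\mathbb T$ we have $\chi_E\in X$, and there is $c_E>0$ with $\int_E|f|\,d\mu\le c_E\|f\|_X$ for all $f\in X$. For $h>0$ let $$A_hf(x)=\frac1h\int_{x-h/2}^{x+h/2}f(t)\,dt,\qquad \dot A_hf(x)=A_hf\left(x+\tfrac h2\right),$$ and assume (Assumption A) that $A_hf\in X$ for all $f\in X$, $h>0$, and $\sup_{h>0,\ \|f\|_X\le1}\|A_hf\|_X<\infty$. Let $\gamma,\gamma'>0$. For each $n\ge1$ let $(x_{k,n})_{k=1}^{m_n}$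 be nodes on the circle such that, with $x_{m_n+1,n}=x_{1,n}+2\pi$, $$\frac{\gamma}{n}\le x_{k+1,n}-x_{k,n}\le\frac{\gamma'}{n},\qquad k=1,\dots,m_n,$$ let $\varphi_{k,n}\in X$, and put $$G_nf(x)=\sum_{k=1}^{m_n}f(x_{k,n})\varphi_{k,n}(x),\qquad \|f\|_{X_n}=\Big\|\sum_{k=1}^{m_n}|f(x_{k,n})|\chi_{[x_{k,n},x_{k+1,n})}\Big\|_X .$$ Let $\mathcal T_n$ be the set of trigonometric polynomials of degree at most $n$. **Theorem 3.1.** Let $r,s\ge1$ be integers with $2r\ge s$, and let $X$ satisfy Assumption A. Suppose that, for constants $K_1,K_3>0$ and all $n\ge1$, $$\|G_nf\|_X\le K_1\|f\|_{X_n}\quad(f\in X),\tag{$A_1$}$$ $$\|T-G_nT\|_X\le K_3n^{-s}\|T^{(s)}\|_X\quad(T\in\mathcal T_n).\tag{$A_3$}$$ Then, for all $n\ge1$ and $f\in X$, $$\|f-G_nf\|_X\le C\left(\|(I-\dot A_{\gamma/n})^sf\|_X+\|(I-A_{\gamma/n})^rf\|_{X_n}\right).$$ If, additionally, $G_nf\in\mathcal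 T_n$ for all $n\ge1$ and $f\in X$, then, for all $n\ge1$ and $f\in X$, $$\|f-G_nf\|_{X_n}\le C\left(\|(I-\dot A_{\gamma/n})^sf\|_X+\|(I-A_{\gamma/n})^rf\|_{X_n}\right).$$ In both estimates the constant $C$ is independent of $f$ and $n$; it depends only on $X,r,s,\gamma,\gamma',K_1,K_3$. -/

import Mathlib

noncomputable section

/-- Indicator function of a set `E`, made `2π`-periodic. When `E` lies in a half-open interval of
length at most `2π`, this is the indicator function of `E` viewed as a subset of the circle. -/
def periodicIndicator (E : Set ℝ) : ℝ → ℂ :=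
  Set.indicator {t : ℝ | ∃ j : ℤ, t + 2 * Real.pi * j ∈ E} (fun _ => 1)

/-- A Banach function lattice on the circle `𝕋 = [-π, π)`. Functions on the circle are
`2π`-periodic functions `ℝ → ℂ`; they are finite-valued and determined at every point, while the
norm sees them only up to equality almost everywhere (so that, by `lattice` and `integral_bound`,
a function of norm zero is the same as a member vanishing almost everywhere). Measurable means
Lebesgue measurable. The values of `norm` outside `carrier` carry no meaning. -/
structure PeriodicBanachLattice where
  /-- the functions that belong to the space -/
  carrier : Submodule ℂ (ℝ → ℂ)
  /-- the norm of the space -/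
  norm : (ℝ → ℂ) → ℝ
  periodic : ∀ f ∈ carrier, Function.Periodic f (2 * Real.pi)
  measurable : ∀ f ∈ carrier, MeasureTheory.AEStronglyMeasurable f MeasureTheory.volume
  norm_nonneg : ∀ f ∈ carrier, 0 ≤ norm f
  norm_add_le : ∀ f ∈ carrier, ∀ g ∈ carrier, norm (f + g) ≤ norm f + norm g
  norm_smul : ∀ (c : ℂ), ∀ f ∈ carrier, norm (c • f) = ‖c‖ * norm f
  /-- completeness -/
  complete : ∀ u : ℕ → ℝ → ℂ, (∀ k, u k ∈ carrier) →
    (∀ ε > 0, ∃ N : ℕ, ∀ j ≥ N, ∀ k ≥ N, norm (u j - u k) < ε) →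
    ∃ v ∈ carrier, Filter.Tendsto (fun k => norm (u k - v)) Filter.atTop (nhds 0)
  /-- the lattice (ideal) property -/
  lattice : ∀ f g : ℝ → ℂ, Function.Periodic f (2 * Real.pi) →
    MeasureTheory.AEStronglyMeasurable f MeasureTheory.volume → g ∈ carrier →
    (∀ᵐ t, ‖f t‖ ≤ ‖g t‖) → f ∈ carrier ∧ norm f ≤ norm g
  /-- the Fatou property -/
  fatou : ∀ (u : ℕ → ℝ → ℝ) (v : ℝ → ℝ), (∀ k, (fun t => (u k t : ℂ)) ∈ carrier) →
    BddAbove (Set.range fun k => norm (fun t => (u k t : ℂ))) →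
    (∀ k t, 0 ≤ u k t) → (∀ t, Monotone fun k => u k t) →
    (∀ t, Filter.Tendsto (fun k => u k t) Filter.atTop (nhds (v t))) →
    (fun t => (v t : ℂ)) ∈ carrier ∧
      Filter.Tendsto (fun k => norm (fun t => (u k t : ℂ))) Filter.atTop
        (nhds (norm (fun t => (v t : ℂ))))
  indicator_mem : ∀ E : Set ℝ, MeasurableSet E → E ⊆ Set.Ico (-Real.pi) Real.pi →
    periodicIndicator E ∈ carrier
  /-- integrals over sets, with respect to the normalized measure on the circle, are controlled
  by the norm -/
  integral_bound : ∀ E : Set ℝ, MeasurableSet E → E ⊆ Set.Ico (-Real.pi) Real.pi →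
    ∃ c > 0, ∀ f ∈ carrier, MeasureTheory.IntegrableOn f E ∧
      (2 * Real.pi)⁻¹ * ∫ t in E, ‖f t‖ ≤ c * norm f

/-- The Steklov average `A_h f(x) = h⁻¹ ∫_{x - h/2}^{x + h/2} f`. -/
def steklov (h : ℝ) (f : ℝ → ℂ) : ℝ → ℂ :=
  fun x => (h : ℂ)⁻¹ * ∫ t in (x - h / 2)..(x + h / 2), f t

/-- The shifted Steklov average `Ȧ_h f(x) = A_h f(x + h/2)`. -/
def steklovDot (h : ℝ) (f : ℝ → ℂ) : ℝ → ℂ :=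
  fun x => steklov h f (x + h / 2)

/-- `(I - A_h)^r f`. -/
def steklovDiff (h : ℝ) (r : ℕ) (f : ℝ → ℂ) : ℝ → ℂ :=
  (fun g => g - steklov h g)^[r] f

/-- `(I - Ȧ_h)^s f`. -/
def steklovDotDiff (h : ℝ) (s : ℕ) (f : ℝ → ℂ) : ℝ → ℂ :=
  (fun g => g - steklovDot h g)^[s] f

/-- The Steklov averages `A_h`, `h > 0`, map the space into itself and are uniformly bounded. -/
def PeriodicBanachLattice.SteklovBounded (X : PeriodicBanachLattice) : Prop :=
  (∀ f ∈ X.carrier, ∀ h > 0, steklov h f ∈ X.carrier) ∧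
  ∃ M : ℝ, ∀ h > 0, ∀ f ∈ X.carrier, X.norm f ≤ 1 → X.norm (steklov h f) ≤ M

/-- Trigonometric polynomials of degree at most `n`. -/
def trigPoly (n : ℕ) : Set (ℝ → ℂ) :=
  {T | ∃ c : ℤ → ℂ, T = fun x : ℝ =>
    ∑ k ∈ Finset.Icc (-(n : ℤ)) (n : ℤ), c k * Complex.exp (Complex.I * (k : ℂ) * (x : ℂ))}

/-- The data of a sequence of linear sampling operators with values in `X`: for each `n ≥ 1` nodes
`x_{1,n} < … < x_{m_n,n}` on the circle, represented by reals, with the convention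
`x_{m_n+1,n} = x_{1,n} + 2π` and with gaps between `γ / n` and `δ / n`, and functions `φ_{k,n}`.
Only the indices `n ≥ 1`, `1 ≤ k ≤ m_n` (for the nodes also `k = m_n + 1`) matter. -/
structure SamplingScheme (X : PeriodicBanachLattice) (γ δ : ℝ) where
  m : ℕ → ℕ
  node : ℕ → ℕ → ℝ
  phi : ℕ → ℕ → ℝ → ℂ
  node_wrap : ∀ n ≥ 1, node n (m n + 1) = node n 1 + 2 * Real.pi
  gap_lower : ∀ n ≥ 1, ∀ k ∈ Finset.Icc 1 (m n), γ / n ≤ node n (k + 1) - node n k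
  gap_upper : ∀ n ≥ 1, ∀ k ∈ Finset.Icc 1 (m n), node n (k + 1) - node n k ≤ δ / n
  phi_mem : ∀ n ≥ 1, ∀ k ∈ Finset.Icc 1 (m n), phi n k ∈ X.carrier

namespace SamplingScheme

variable {X : PeriodicBanachLattice} {γ δ : ℝ}

/-- The sampling operator `G_n f(x) = ∑_{k=1}^{m_n} f(x_{k,n}) φ_{k,n}(x)`. -/
def op (G : SamplingScheme X γ δ) (n : ℕ) (f : ℝ → ℂ) : ℝ → ℂ :=
  fun x => ∑ k ∈ Finset.Icc 1 (G.m n), f (G.node n k) * G.phi n k x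

/-- The discrete seminorm `‖∑_{k=1}^{m_n} |f(x_{k,n})| χ_{[x_{k,n}, x_{k+1,n})}‖_X`. -/
def discNorm (G : SamplingScheme X γ δ) (n : ℕ) (f : ℝ → ℂ) : ℝ :=
  X.norm (fun t => ∑ k ∈ Finset.Icc 1 (G.m n),
    ((‖f (G.node n k)‖ : ℝ) : ℂ) *
      periodicIndicator (Set.Ico (G.node n k) (G.node n (k + 1))) t)

/-- The stability bound `‖G_n f‖_X ≤ K ‖f‖_{X_n}`. -/
def Stable (G : SamplingScheme X γ δ) (K : ℝ) : Prop :=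
  ∀ n ≥ 1, ∀ f ∈ X.carrier, X.norm (G.op n f) ≤ K * G.discNorm n f

/-- The Jackson bound `‖T - G_n T‖_X ≤ K n^{-s} ‖T^{(s)}‖_X` for polynomials `T` of degree at
most `n`. -/
def PolyJackson (G : SamplingScheme X γ δ) (s : ℕ) (K : ℝ) : Prop :=
  ∀ n ≥ 1, ∀ T ∈ trigPoly n,
    X.norm (T - G.op n T) ≤ K * ((n : ℝ) ^ s)⁻¹ * X.norm (iteratedDeriv s T)

end SamplingScheme

end

/-! Put `h = γ / n`. Everything rests on a polynomial `T` of degree at most `n` for which both `‖f -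
T‖_X` and `n^{-s} ‖T^{(s)}‖_X` are controlled by `‖(I - Ȧ_h)^s f‖_X` (`exists_trig_approximation`).
In `f - G_n f = (f - T) + (T - G_n T) - G_n (f - T)` the Jackson bound handles the second term, and
stability reduces the third to the discrete seminorm of `f - T`.

The norm of `X` does not control point values of `f - T`, so it is split as `(I - A_h)^r f - (I -
A_h)^r T` plus `(f - T) - (I - A_h)^r (f - T)`. The last piece is a sum of Steklov averages, which
can be sampled safely (`discNorm_sub_steklovDiff_le`). The polynomial piece can be sampled as well
(`discNorm_trig_le`), and each factor `I - A_h` gains `h²` against two derivatives; with `2r ≥ s`,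
Bernstein's inequality brings this back to `T^{(s)}` (`discNorm_steklovDiff_trig_le`).

No translation invariance of `X` is assumed, so convolution inequalities are not at hand. Instead,
norm bounds for averages and kernel means come from pointwise domination by finite weighted sums of
centred averages of `|g|`, to which Assumption A applies (`norm_le_of_absAvg`); decaying kernels are
cut into dyadic layers (`dyadicAvg`).

The core of the approximation part is `norm_steklovDot_shift_sub_le`. The average `c = Ȧ_h f`
satisfies `h c' = f(· + h) - f`, that is, `h c' + c = c(· + h)` up to terms in `f - c`. Integrating
this, the radius of a ball containing the values of `c` on a window shrinks by the factor `1 - 1/e`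
compared with the next window to the right, up to averages of `|f - c|`; iteration gives a
convergent series. Thus one first difference controls smoothness, a Jackson kernel mean `V`
approximates to first order, and `f - (I - V)^s f` approximates to order `s` because `V` commutes
with `Ȧ_h`. -/

noncomputable section

open MeasureTheory intervalIntegral Set

/-! ### Centred averages of absolute values. -/

/-- The average of `‖g‖` over the interval of length `H` centred at `x`. -/
def absAvg (H : ℝ) (g : ℝ → ℂ) (x : ℝ) : ℝ :=
  H⁻¹ * ∫ t in (x - H / 2)..(x + H / 2), ‖g t‖

lemma ofReal_absAvg (H : ℝ) (g : ℝ → ℂ) (x : ℝ) :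
    ((absAvg H g x : ℝ) : ℂ) = steklov H (fun t => ((‖g t‖ : ℝ) : ℂ)) x := by
  simp only [absAvg, steklov, Complex.ofReal_mul, Complex.ofReal_inv,
    intervalIntegral.integral_ofReal]

lemma absAvg_nonneg {H : ℝ} (hH : 0 < H) (g : ℝ → ℂ) (x : ℝ) : 0 ≤ absAvg H g x := by
  refine mul_nonneg (inv_nonneg.2 hH.le) (integral_nonneg (by linarith) fun t _ => norm_nonneg _)

lemma integral_norm_le_absAvg {g : ℝ → ℂ} (hg : ∀ a b, IntervalIntegrable g volume a b)
    {a b x H : ℝ} (hab : a ≤ b) (ha : x - H / 2 ≤ a) (hb : b ≤ x + H / 2) (hH : 0 < H) :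
    ∫ t in a..b, ‖g t‖ ≤ H * absAvg H g x := by
  rw [absAvg, mul_inv_cancel_left₀ hH.ne']
  exact integral_mono_interval ha hab hb (Filter.Eventually.of_forall fun t => norm_nonneg _)
    (hg _ _).norm

/-- Enlarging the window by `d` on both sides absorbs a change of centre; the price is the ratio of
the lengths. This is how an average at a node is compared with averages at the points of its cell.
-/
lemma absAvg_le_absAvg {g : ℝ → ℂ} (hg : ∀ a b, IntervalIntegrable g volume a b)
    {x y H d : ℝ} (hH : 0 < H) (hd : |x - y| ≤ d) :
    absAvg H g y ≤ (H + 2 * d) / H * absAvg (H + 2 * d) g x := by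
  have h0 : 0 ≤ d := (abs_nonneg _).trans hd
  have := abs_le.1 hd
  have h1 := integral_norm_le_absAvg hg (a := y - H / 2) (b := y + H / 2) (x := x)
    (H := H + 2 * d) (by linarith) (by linarith) (by linarith) (by linarith)
  rw [div_mul_eq_mul_div, le_div_iff₀ hH, absAvg, mul_comm, mul_inv_cancel_left₀ hH.ne']
  exact h1

lemma absAvg_periodic {g : ℝ → ℂ} (hg : Function.Periodic g (2 * Real.pi)) (H : ℝ) :
    Function.Periodic (absAvg H g) (2 * Real.pi) := by
  intro x
  simp only [absAvg]
  congr 1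
  have h := intervalIntegral.integral_comp_add_right (a := x - H / 2) (b := x + H / 2)
    (fun t => ‖g t‖) (2 * Real.pi)
  rw [show x + 2 * Real.pi - H / 2 = x - H / 2 + 2 * Real.pi by ring,
    show x + 2 * Real.pi + H / 2 = x + H / 2 + 2 * Real.pi by ring, ← h]
  simp only [hg _]

/-! ### Lattice norms, and the passage from pointwise bounds to norm bounds. -/

namespace PeriodicBanachLattice

variable (X : PeriodicBanachLattice)

lemma intervalIntegrable {f : ℝ → ℂ} (hf : f ∈ X.carrier) (a b : ℝ) :
    IntervalIntegrable f volume a b := by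
  obtain ⟨c, -, hc⟩ := X.integral_bound (Ico (-Real.pi) Real.pi) measurableSet_Ico subset_rfl
  have h1 := (hc f hf).1
  refine (X.periodic f hf).intervalIntegrable (by positivity) (t := -Real.pi) ?_ a b
  rw [show -Real.pi + 2 * Real.pi = Real.pi by ring,
    intervalIntegrable_iff_integrableOn_Ico_of_le (by linarith [Real.pi_pos])]
  exact h1

lemma periodicIndicator_Ico_pi : periodicIndicator (Ico (-Real.pi) Real.pi) = fun _ => 1 := by
  funext t
  refine indicator_of_mem ?_ _
  refine ⟨-toIcoDiv Real.two_pi_pos (-Real.pi) t, ?_⟩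
  have := sub_toIcoDiv_zsmul_mem_Ico Real.two_pi_pos (-Real.pi) t
  rw [zsmul_eq_mul, show -Real.pi + 2 * Real.pi = Real.pi by ring] at this
  convert this using 1
  push_cast
  ring

lemma one_mem : (fun _ => 1 : ℝ → ℂ) ∈ X.carrier := by
  rw [← periodicIndicator_Ico_pi]
  exact X.indicator_mem _ measurableSet_Ico subset_rfl

variable {X}

lemma norm_zero : X.norm 0 = 0 := by
  simpa using X.norm_smul 0 0 X.carrier.zero_mem

lemma norm_neg {f : ℝ → ℂ} (hf : f ∈ X.carrier) : X.norm (-f) = X.norm f := by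
  simpa using X.norm_smul (-1) f hf

lemma norm_sub_le {f g : ℝ → ℂ} (hf : f ∈ X.carrier) (hg : g ∈ X.carrier) :
    X.norm (f - g) ≤ X.norm f + X.norm g := by
  rw [sub_eq_add_neg, ← norm_neg hg]
  exact X.norm_add_le _ hf _ (X.carrier.neg_mem hg)

lemma norm_sum_le {ι : Type*} (s : Finset ι) {f : ι → ℝ → ℂ} (hf : ∀ i ∈ s, f i ∈ X.carrier) :
    X.norm (∑ i ∈ s, f i) ≤ ∑ i ∈ s, X.norm (f i) := by
  classical
  induction s using Finset.induction_on with
  | empty => simp [norm_zero]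
  | insert a s ha ih =>
    rw [Finset.sum_insert ha, Finset.sum_insert ha]
    have h2 : ∀ i ∈ s, f i ∈ X.carrier := fun i hi => hf i (Finset.mem_insert_of_mem hi)
    exact (X.norm_add_le _ (hf a (Finset.mem_insert_self a s)) _ (X.carrier.sum_mem h2)).trans
      (by gcongr; exact ih h2)

lemma abs_mem {g : ℝ → ℂ} (hg : g ∈ X.carrier) :
    (fun t => ((‖g t‖ : ℝ) : ℂ)) ∈ X.carrier ∧ X.norm (fun t => ((‖g t‖ : ℝ) : ℂ)) ≤ X.norm g := by
  refine X.lattice _ _ (fun t => by simp only [X.periodic g hg t]) ?_ hg (by simp)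
  exact Complex.continuous_ofReal.comp_aestronglyMeasurable (X.measurable g hg).norm

/-- A bound for the Steklov averages on `X`, homogeneous in the function. -/
def SteklovBound (X : PeriodicBanachLattice) (M : ℝ) : Prop :=
  0 ≤ M ∧ ∀ h > 0, ∀ f ∈ X.carrier, steklov h f ∈ X.carrier ∧ X.norm (steklov h f) ≤ M * X.norm f

lemma steklov_smul (h : ℝ) (c : ℂ) (f : ℝ → ℂ) : steklov h (c • f) = c • steklov h f := by
  funext x
  simp only [steklov, Pi.smul_apply, smul_eq_mul, intervalIntegral.integral_const_mul]
  ring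

lemma SteklovBounded.exists_bound (hA : X.SteklovBounded) : ∃ M, X.SteklovBound M := by
  obtain ⟨h1, M, hM⟩ := hA
  refine ⟨max M 0, le_max_right _ _, fun h hh f hf => ⟨h1 f hf h hh, ?_⟩⟩
  have key : ∀ c : ℝ, 0 ≤ c → c * X.norm f ≤ 1 → c * X.norm (steklov h f) ≤ max M 0 := by
    intro c hc hcf
    have h2 := hM h hh ((c : ℂ) • f) (X.carrier.smul_mem _ hf)
      (by rw [X.norm_smul _ _ hf]; simpa [abs_of_nonneg hc] using hcf)
    rw [steklov_smul, X.norm_smul _ _ (h1 f hf h hh)] at h2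
    simp only [Complex.norm_real, Real.norm_eq_abs, abs_of_nonneg hc] at h2
    exact h2.trans (le_max_left _ _)
  have hn := X.norm_nonneg _ (h1 f hf h hh)
  rcases (X.norm_nonneg f hf).eq_or_lt with h0 | h0
  · rw [← h0, mul_zero]
    by_contra! hpos
    -- When `f` has norm zero, all its multiples lie in the unit ball, so a large enough multiple
    -- would violate the uniform bound.
    have h3 := key ((max M 0 + 1) / X.norm (steklov h f)) (by positivity) (by simp [← h0])
    rw [div_mul_cancel₀ _ hpos.ne'] at h3
    linarith
  · have h3 := key (X.norm f)⁻¹ (by positivity) (by rw [inv_mul_cancel₀ h0.ne'])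
    rwa [inv_mul_eq_div, div_le_iff₀ h0] at h3

/-- The centred averages of `‖g‖` are Steklov averages of a member of `X`, so Assumption A bounds
each of them, and the lattice property transfers the bound to `u`. The constant `κ` leaves room for
the remainder of a truncated series, so that finite sums suffice. -/
lemma norm_le_of_absAvg {M : ℝ} (hM : X.SteklovBound M) {g u : ℝ → ℂ} (hg : g ∈ X.carrier)
    (hup : Function.Periodic u (2 * Real.pi)) (hum : AEStronglyMeasurable u volume)
    {ι : Type*} (s : Finset ι) (w H : ι → ℝ) {κ : ℝ} (hw : ∀ i ∈ s, 0 ≤ w i)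
    (hH : ∀ i ∈ s, 0 < H i) (hκ : 0 ≤ κ)
    (h : ∀ x, ‖u x‖ ≤ ∑ i ∈ s, w i * absAvg (H i) g x + κ) :
    u ∈ X.carrier ∧ X.norm u ≤ (∑ i ∈ s, w i) * M * X.norm g + κ * X.norm (fun _ => 1) := by
  set a : ℝ → ℂ := fun t => ((‖g t‖ : ℝ) : ℂ)
  obtain ⟨ha, ha'⟩ := abs_mem hg
  set v : ℝ → ℂ := ∑ i ∈ s, (w i : ℂ) • steklov (H i) a with hv
  have hmem : ∀ i ∈ s, (w i : ℂ) • steklov (H i) a ∈ X.carrier := fun i hi =>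
    X.carrier.smul_mem _ (hM.2 _ (hH i hi) a ha).1
  have hvm : v ∈ X.carrier := X.carrier.sum_mem hmem
  set o : ℝ → ℂ := (κ : ℂ) • fun _ => 1
  have hom : o ∈ X.carrier := X.carrier.smul_mem _ X.one_mem
  have hval : ∀ x, (v + o) x = ((∑ i ∈ s, w i * absAvg (H i) g x + κ : ℝ) : ℂ) := by
    intro x
    simp [hv, o, ofReal_absAvg, a]
  obtain ⟨h1, h2⟩ := X.lattice u (v + o) hup hum (X.carrier.add_mem hvm hom) (by
    refine Filter.Eventually.of_forall fun x => ?_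
    rw [hval, Complex.norm_real]
    exact (h x).trans (le_abs_self _))
  refine ⟨h1, h2.trans ((X.norm_add_le _ hvm _ hom).trans ?_)⟩
  gcongr
  · refine (norm_sum_le s hmem).trans ?_
    rw [Finset.sum_mul, Finset.sum_mul]
    refine Finset.sum_le_sum fun i hi => ?_
    rw [X.norm_smul _ _ (hM.2 _ (hH i hi) a ha).1, mul_assoc]
    have := (hM.2 _ (hH i hi) a ha).2
    have h0 := hM.1
    simp only [Complex.norm_real, Real.norm_eq_abs, abs_of_nonneg (hw i hi)]
    have hwi := hw i hi
    gcongr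
    exact this.trans (by gcongr)
  · rw [X.norm_smul _ _ X.one_mem]
    simp [abs_of_nonneg hκ]

end PeriodicBanachLattice

/-! ### Steklov averages: linearity, periodicity, continuity, derivatives. -/

lemma steklovDot_eq (h : ℝ) (f : ℝ → ℂ) (x : ℝ) :
    steklovDot h f x = (h : ℂ)⁻¹ * ∫ t in x..(x + h), f t := by
  rw [steklovDot, steklov]
  congr 2 <;> ring

lemma steklov_eq_steklovDot (h : ℝ) (f : ℝ → ℂ) (x : ℝ) :
    steklov h f x = steklovDot h f (x - h / 2) := by
  simp [steklovDot]

lemma steklov_sub {f g : ℝ → ℂ} (hf : ∀ a b, IntervalIntegrable f volume a b)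
    (hg : ∀ a b, IntervalIntegrable g volume a b) (h : ℝ) :
    steklov h (f - g) = steklov h f - steklov h g := by
  funext x
  simp only [steklov, Pi.sub_apply]
  rw [intervalIntegral.integral_sub (hf _ _) (hg _ _), mul_sub]

lemma steklovDot_sub {f g : ℝ → ℂ} (hf : ∀ a b, IntervalIntegrable f volume a b)
    (hg : ∀ a b, IntervalIntegrable g volume a b) (h : ℝ) :
    steklovDot h (f - g) = steklovDot h f - steklovDot h g := by
  funext x
  simp [steklovDot, steklov_sub hf hg]

lemma continuous_steklovDot {f : ℝ → ℂ} (hf : ∀ a b, IntervalIntegrable f volume a b) (h : ℝ) :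
    Continuous (steklovDot h f) := by
  have h1 : Continuous fun x => ∫ t in (0 : ℝ)..x, f t := continuous_primitive hf 0
  have h2 : steklovDot h f = fun x => (h : ℂ)⁻¹ *
      ((∫ t in (0 : ℝ)..(x + h), f t) - ∫ t in (0 : ℝ)..x, f t) := by
    funext x
    rw [steklovDot_eq, integral_interval_sub_left (hf _ _) (hf _ _)]
  rw [h2]
  exact continuous_const.mul ((h1.comp (continuous_id.add continuous_const)).sub h1)

lemma steklov_periodic {f : ℝ → ℂ} {T : ℝ} (hf : Function.Periodic f T) (h : ℝ) :
    Function.Periodic (steklov h f) T := by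
  intro x
  simp only [steklov]
  congr 1
  have h1 := intervalIntegral.integral_comp_add_right (a := x - h / 2) (b := x + h / 2) f T
  rw [show x + T - h / 2 = x - h / 2 + T by ring,
    show x + T + h / 2 = x + h / 2 + T by ring, ← h1]
  simp only [hf _]

lemma steklovDot_periodic {f : ℝ → ℂ} {T : ℝ} (hf : Function.Periodic f T) (h : ℝ) :
    Function.Periodic (steklovDot h f) T := by
  intro x
  simp only [steklovDot]
  rw [show x + T + h / 2 = x + h / 2 + T by ring, steklov_periodic hf]

lemma hasDerivAt_steklovDot {f : ℝ → ℂ} (hf : Continuous f) (h x : ℝ) :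
    HasDerivAt (steklovDot h f) ((h : ℂ)⁻¹ * (f (x + h) - f x)) x := by
  have hi : ∀ a b, IntervalIntegrable f volume a b := fun a b => hf.intervalIntegrable a b
  have h1 : ∀ y, HasDerivAt (fun x => ∫ t in (0 : ℝ)..x, f t) (f y) y := fun y =>
    hf.integral_hasStrictDerivAt 0 y |>.hasDerivAt
  have h2 : steklovDot h f = fun x => (h : ℂ)⁻¹ *
      ((∫ t in (0 : ℝ)..(x + h), f t) - ∫ t in (0 : ℝ)..x, f t) := by
    funext x
    rw [steklovDot_eq, integral_interval_sub_left (hi _ _) (hi _ _)]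
  rw [h2]
  exact (((h1 (x + h)).comp_add_const x h).sub (h1 x)).const_mul _

namespace PeriodicBanachLattice

variable {X : PeriodicBanachLattice}

/-- The window `[x, x + h]` of the shifted average lies in the centred window of length `2 h`, which
costs the factor `2`. -/
lemma steklovDot_bound {M : ℝ} (hM : X.SteklovBound M) {h : ℝ} (hh : 0 < h) {f : ℝ → ℂ}
    (hf : f ∈ X.carrier) :
    steklovDot h f ∈ X.carrier ∧ X.norm (steklovDot h f) ≤ 2 * M * X.norm f := by
  have hi := X.intervalIntegrable hf
  have := norm_le_of_absAvg hM hf (steklovDot_periodic (X.periodic f hf) h)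
    (continuous_steklovDot hi h).aestronglyMeasurable (Finset.univ : Finset Unit)
    (fun _ => 2) (fun _ => 2 * h) (κ := 0) (by simp) (by simpa using hh) le_rfl (by
      intro x
      simp only [Finset.univ_unique, Finset.sum_const, Finset.card_singleton, one_smul, add_zero]
      rw [steklovDot_eq, norm_mul, norm_inv, Complex.norm_real, Real.norm_eq_abs, abs_of_pos hh]
      have h1 := norm_integral_le_integral_norm (f := f) (μ := volume) (a := x) (b := x + h)
        (by linarith)
      have h2 := integral_norm_le_absAvg hi (a := x) (b := x + h) (x := x) (H := 2 * h)
        (by linarith) (by linarith) (by linarith) (by linarith)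
      rw [inv_mul_le_iff₀ hh]
      linarith)
  simpa using this

end PeriodicBanachLattice

/-! ### The contraction argument: one difference controls the oscillation of an average. -/

/-- Contraction for the moving average `c t = ∫_t^{t+1} f`: control of `c` on `[0,1]` by a ball
propagates to `[-1,0]` with a smaller radius, up to an error measured by `f - c`. -/
lemma exists_center_of_moving_average {f c : ℝ → ℂ} (hf : Continuous f)
    (hc : ∀ t, c t = ∫ τ in t..(t + 1), f τ) {p : ℂ} {ρ : ℝ}
    (hρ : ∀ t ∈ Icc (0 : ℝ) 1, ‖c t - p‖ ≤ ρ) :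
    ∃ p' : ℂ, ∀ y ∈ Icc (-1 : ℝ) 0, ‖c y - p'‖ ≤ (1 - Real.exp (-1)) * ρ +
      Real.exp 1 * ∫ t in (-1 : ℝ)..1, ‖f t - c t‖ := by
  have hc' : ∀ t, HasDerivAt c (f (t + 1) - f t) t := by
    intro t
    have h1 := hasDerivAt_steklovDot hf 1 t
    have h2 : c = steklovDot 1 f := by
      funext x
      rw [hc, steklovDot_eq]
      simp
    rw [h2]
    simpa using h1
  have hcc : Continuous c := continuous_iff_continuousAt.2 fun t => (hc' t).continuousAt
  set g : ℝ → ℂ := fun t => f t - c t with hg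
  set G : ℝ → ℂ := fun t => c (t + 1) - p with hG
  have hgc : Continuous g := hf.sub hcc
  have hGc : Continuous G := by fun_prop
  have hGρ : ∀ t ∈ Icc (-1 : ℝ) 0, ‖G t‖ ≤ ρ := fun t ht =>
    hρ _ ⟨by linarith [ht.1], by linarith [ht.2]⟩
  have hρ0 : 0 ≤ ρ := (_root_.norm_nonneg _).trans (hρ 0 (by simp))
  set e : ℝ → ℂ := fun t => ((Real.exp t : ℝ) : ℂ) with he
  have hec : Continuous e := by fun_prop
  have hed : ∀ t, HasDerivAt e (e t) t := fun t => (Real.hasDerivAt_exp t).ofReal_comp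
  -- Each `c y - p` is an average of `G` of total mass one, with weight `e^{-y}` on `[-1, y]` and
  -- `e^{-y} (1 - e^t)` on `[y, 0]`, plus terms in `g`. All these weights dominate `1 - e^t`, which
  -- has mass `e^{-1}`; moving this common part into the centre leaves mass `1 - e^{-1}`.
  refine ⟨p + ∫ t in (-1 : ℝ)..0, (1 - e t) * G t, fun y hy => ?_⟩
  have hcont : ∀ {u : ℝ → ℂ}, Continuous u → ∀ a b, IntervalIntegrable u volume a b :=
    fun h a b => h.intervalIntegrable a b
  have hg1 : Continuous fun t => g (t + 1) := by fun_prop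
  -- Integrating factor `e^t` for `c' + (c - p) = G + g(· + 1) - g`.
  have h1 : (c 0 - p) - e y * (c y - p) = ∫ t in y..0, e t * (G t + g (t + 1) - g t) := by
    have hd : ∀ t ∈ uIcc y 0, HasDerivAt (fun t => e t * (c t - p))
        (e t * (G t + g (t + 1) - g t)) t := by
      intro t _
      refine ((hed t).mul ((hc' t).sub_const p)).congr_deriv ?_
      simp only [hG, hg]
      ring
    rw [integral_eq_sub_of_hasDerivAt hd (hcont (by fun_prop) _ _)]
    simp [he]
  -- The missing initial value: `c 0` is itself the mean of `f` over `[0, 1]`.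
  have h2 : c 0 - p = ∫ t in (-1 : ℝ)..0, (G t + g (t + 1)) := by
    have h3 : ∀ t, G t + g (t + 1) = f (t + 1) - p := fun t => by simp only [hG, hg]; ring
    simp only [h3]
    rw [intervalIntegral.integral_sub (hcont (by fun_prop) _ _) (by simp),
      intervalIntegral.integral_comp_add_right f 1, hc]
    simp
  have hE : ((Real.exp (-y) : ℝ) : ℂ) * e y = 1 := by
    simp only [he]
    rw [← Complex.ofReal_mul, ← Real.exp_add]
    simp
  set E : ℝ := Real.exp (-y) with hEdef
  have h4 : c y - (p + ∫ t in (-1 : ℝ)..0, (1 - e t) * G t) =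
      (∫ t in (-1 : ℝ)..y, ((E : ℂ) - 1 + e t) * G t + E * g (t + 1)) +
      ∫ t in y..0, ((E : ℂ) - 1) * (1 - e t) * G t + E * (1 - e t) * g (t + 1) + E * e t * g t := by
    have h5 : c y - p = E * ((∫ t in (-1 : ℝ)..0, (G t + g (t + 1))) -
        ∫ t in y..0, e t * (G t + g (t + 1) - g t)) := by
      rw [← h1, ← h2]
      linear_combination -(c y - p) * hE
    rw [← sub_sub, h5, ← integral_add_adjacent_intervals (b := y)
      (hcont (u := fun t => G t + g (t + 1)) (by fun_prop) _ _) (hcont (by fun_prop) _ _),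
      ← integral_add_adjacent_intervals (b := y)
      (hcont (u := fun t => (1 - e t) * G t) (by fun_prop) _ _) (hcont (by fun_prop) _ _),
      add_sub_assoc, ← intervalIntegral.integral_sub (hcont (by fun_prop) _ _)
        (hcont (by fun_prop) _ _), mul_add, add_sub_add_comm,
      ← intervalIntegral.integral_const_mul, ← intervalIntegral.integral_const_mul,
      ← intervalIntegral.integral_sub (hcont (by fun_prop) _ _) (hcont (by fun_prop) _ _),
      ← intervalIntegral.integral_sub (hcont (by fun_prop) _ _) (hcont (by fun_prop) _ _)]
    congr 1 <;> refine integral_congr fun t _ => ?_ <;> ring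
  have hE1 : 1 ≤ E := Real.one_le_exp (by linarith [hy.2])
  have hEe : E ≤ Real.exp 1 := Real.exp_le_exp.2 (by linarith [hy.1])
  have het : ∀ t, ‖e t‖ = Real.exp t := fun t => by simp [he]
  have h1e : ∀ t ≤ (0 : ℝ), ‖1 - e t‖ = 1 - Real.exp t := by
    intro t ht
    rw [he, ← Complex.ofReal_one, ← Complex.ofReal_sub, Complex.norm_real, Real.norm_eq_abs,
      abs_of_nonneg (by linarith [Real.exp_le_one_iff.2 ht])]
  have hEn : ‖(E : ℂ)‖ = E := by rw [Complex.norm_real, Real.norm_eq_abs, abs_of_pos (by linarith)]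
  have hE1n : ‖(E : ℂ) - 1‖ = E - 1 := by
    rw [← Complex.ofReal_one, ← Complex.ofReal_sub, Complex.norm_real, Real.norm_eq_abs,
      abs_of_nonneg (by linarith)]
  have hrc : ∀ {u : ℝ → ℝ}, Continuous u → ∀ a b, IntervalIntegrable u volume a b :=
    fun h a b => h.intervalIntegrable a b
  have b1 : ‖∫ t in (-1 : ℝ)..y, ((E : ℂ) - 1 + e t) * G t + E * g (t + 1)‖ ≤
      ∫ t in (-1 : ℝ)..y, (E - 1 + Real.exp t) * ρ + Real.exp 1 * ‖g (t + 1)‖ := by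
    refine norm_integral_le_of_norm_le hy.1 (Filter.Eventually.of_forall fun t ht => ?_)
      (hrc (by fun_prop) _ _)
    refine (norm_add_le _ _).trans ?_
    rw [norm_mul, norm_mul, hEn]
    refine add_le_add (mul_le_mul ((norm_add_le _ _).trans (by rw [hE1n, het]))
      (hGρ t ⟨ht.1.le, ht.2.trans hy.2⟩) (_root_.norm_nonneg _)
      (by linarith [Real.exp_pos t])) (by gcongr)
  have b2 : ‖∫ t in y..0, ((E : ℂ) - 1) * (1 - e t) * G t + E * (1 - e t) * g (t + 1) +
        E * e t * g t‖ ≤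
      ∫ t in y..0, (E - 1) * (1 - Real.exp t) * ρ + Real.exp 1 * ‖g (t + 1)‖ +
        Real.exp 1 * ‖g t‖ := by
    refine norm_integral_le_of_norm_le hy.2 (Filter.Eventually.of_forall fun t ht => ?_)
      (hrc (by fun_prop) _ _)
    refine (norm_add_le _ _).trans (add_le_add ((norm_add_le _ _).trans ?_) ?_)
    · simp only [norm_mul, hE1n, hEn, h1e t ht.2]
      have := Real.exp_le_one_iff.2 ht.2
      have h6 : E * (1 - Real.exp t) ≤ Real.exp 1 := by nlinarith [Real.exp_pos t]
      exact add_le_add (mul_le_mul_of_nonneg_left (hGρ t ⟨by linarith [ht.1, hy.1], ht.2⟩)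
        (mul_nonneg (by linarith) (by linarith))) (by gcongr)
    · simp only [norm_mul, hEn, het]
      have := Real.exp_le_one_iff.2 ht.2
      have h6 : E * Real.exp t ≤ Real.exp 1 := by nlinarith [Real.exp_pos t]
      gcongr
  rw [h4]
  refine (norm_add_le _ _).trans ((add_le_add b1 b2).trans ?_)
  have hng : Continuous fun t => ‖g t‖ := hgc.norm
  have hng1 : Continuous fun t => ‖g (t + 1)‖ := hg1.norm
  have i1 : ∫ t in (-1 : ℝ)..y, (E - 1 + Real.exp t) * ρ =
      ((E - 1) * (y + 1) + (Real.exp y - Real.exp (-1))) * ρ := by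
    rw [intervalIntegral.integral_mul_const, intervalIntegral.integral_add (by simp)
      (hrc (by fun_prop) _ _), integral_exp, intervalIntegral.integral_const, smul_eq_mul]
    ring
  have i2 : ∫ t in y..0, (E - 1) * (1 - Real.exp t) * ρ =
      (E - 1) * (-y - (1 - Real.exp y)) * ρ := by
    rw [intervalIntegral.integral_mul_const, intervalIntegral.integral_const_mul,
      intervalIntegral.integral_sub (by simp) (hrc (by fun_prop) _ _), integral_exp]
    simp
  have i3 : (∫ t in (-1 : ℝ)..y, ‖g (t + 1)‖) + (∫ t in y..0, ‖g (t + 1)‖) =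
      ∫ t in (0 : ℝ)..1, ‖g t‖ := by
    rw [integral_add_adjacent_intervals (hrc hng1 _ _) (hrc hng1 _ _),
      intervalIntegral.integral_comp_add_right (fun t => ‖g t‖) 1]
    norm_num
  have i4 : ∫ t in y..0, ‖g t‖ ≤ ∫ t in (-1 : ℝ)..0, ‖g t‖ :=
    integral_mono_interval hy.1 hy.2 le_rfl
      (Filter.Eventually.of_forall fun t => _root_.norm_nonneg _) (hrc hng _ _)
  have i5 : (∫ t in (-1 : ℝ)..0, ‖g t‖) + ∫ t in (0 : ℝ)..1, ‖g t‖ = ∫ t in (-1 : ℝ)..1, ‖g t‖ :=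
    integral_add_adjacent_intervals (hrc hng _ _) (hrc hng _ _)
  rw [intervalIntegral.integral_add (hrc (by fun_prop) _ _) (hrc (by fun_prop) _ _),
    intervalIntegral.integral_add (hrc (by fun_prop) _ _) (hrc (by fun_prop) _ _),
    intervalIntegral.integral_add (hrc (by fun_prop) _ _) (hrc (by fun_prop) _ _), i1, i2]
  simp only [intervalIntegral.integral_const_mul]
  have hEy : E * Real.exp y = 1 := by rw [hEdef, ← Real.exp_add]; simp
  -- The mass of the remaining weights does not depend on `y`.
  have hfin : ((E - 1) * (y + 1) + (Real.exp y - Real.exp (-1))) * ρ +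
      (E - 1) * (-y - (1 - Real.exp y)) * ρ = (1 - Real.exp (-1)) * ρ := by
    linear_combination ρ * hEy
  have := Real.exp_pos 1
  nlinarith [mul_le_mul_of_nonneg_left i4 this.le]

/-- The substitution `t ↦ x + h + h t` turns the unit-step contraction into one from the window `[x
+ h, x + 2h]` to `[x, x + h]`. -/
lemma exists_center_steklovDot {f : ℝ → ℂ} (hf : Continuous f) {h : ℝ} (hh : 0 < h) (x : ℝ)
    {p : ℂ} {ρ : ℝ} (hρ : ∀ t ∈ Icc (x + h) (x + 2 * h), ‖steklovDot h f t - p‖ ≤ ρ) :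
    ∃ p' : ℂ, ∀ y ∈ Icc x (x + h), ‖steklovDot h f y - p'‖ ≤ (1 - Real.exp (-1)) * ρ +
      Real.exp 1 * (h⁻¹ * ∫ t in x..(x + 2 * h), ‖(f - steklovDot h f) t‖) := by
  have hc : ∀ t, steklovDot h f (x + h + h * t) = ∫ τ in t..(t + 1), f (x + h + h * τ) := by
    intro t
    rw [steklovDot_eq, intervalIntegral.integral_comp_add_mul f hh.ne' (x + h), Complex.real_smul,
      Complex.ofReal_inv]
    congr 2
    ring
  obtain ⟨p', hp'⟩ := exists_center_of_moving_average
    (f := fun t => f (x + h + h * t)) (c := fun t => steklovDot h f (x + h + h * t))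
    (by fun_prop) hc (p := p) (ρ := ρ) (by
      intro t ht
      refine hρ _ ⟨?_, ?_⟩ <;> nlinarith [ht.1, ht.2])
  refine ⟨p', fun y hy => ?_⟩
  have h1 := hp' ((y - x - h) / h) ⟨by rw [le_div_iff₀ hh]; linarith [hy.1],
    by rw [div_le_iff₀ hh]; linarith [hy.2]⟩
  have h2 : x + h + h * ((y - x - h) / h) = y := by field_simp; ring
  have h3 := intervalIntegral.integral_comp_add_mul (a := -1) (b := 1)
    (fun t => ‖(f - steklovDot h f) t‖) hh.ne' (x + h)
  rw [smul_eq_mul, show x + h + h * (-1) = x by ring, show x + h + h * 1 = x + 2 * h by ring] at h3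
  simp only [Pi.sub_apply] at h3 ⊢
  simp only [h2, h3] at h1
  exact h1

/-- The contraction is applied `J` times, coming from the window `[x + J h, x + (J + 1) h]`. The
error of step `j` lives on `[x + j h, x + (j + 2) h]`, which fits in the window of half-length `(j +
2) h` centred at `x`. The growth in `j` is harmless against the geometric factor. -/
lemma exists_center_steklovDot_iterate {f : ℝ → ℂ} (hf : Continuous f) {h : ℝ} (hh : 0 < h)
    {ρ : ℝ} (hρ : ∀ t, ‖steklovDot h f t‖ ≤ ρ) (J : ℕ) (x : ℝ) :
    ∃ p : ℂ, ∀ y ∈ Icc x (x + h), ‖steklovDot h f y - p‖ ≤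
      (∑ j ∈ Finset.range J, (1 - Real.exp (-1)) ^ j * (2 * Real.exp 1 * (j + 2)) *
        absAvg (2 * (j + 2) * h) (f - steklovDot h f) x) + (1 - Real.exp (-1)) ^ J * ρ := by
  have hint : ∀ a b, IntervalIntegrable (f - steklovDot h f) volume a b := fun a b =>
    (hf.sub (continuous_steklovDot (fun a b => hf.intervalIntegrable a b) h)).intervalIntegrable a b
  set q := 1 - Real.exp (-1) with hq
  have hq0 : 0 ≤ q := by
    have : Real.exp (-1) ≤ 1 := Real.exp_le_one_iff.2 (by norm_num)
    linarith
  set B : ℝ → ℝ := fun x => Real.exp 1 * (h⁻¹ * ∫ t in x..(x + 2 * h), ‖(f - steklovDot h f) t‖)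
  have key : ∀ (J : ℕ) (x : ℝ), ∃ p : ℂ, ∀ y ∈ Icc x (x + h), ‖steklovDot h f y - p‖ ≤
      (∑ j ∈ Finset.range J, q ^ j * B (x + j * h)) + q ^ J * ρ := by
    intro J
    induction J with
    -- Start from the trivial ball: centre `0`, radius the global bound `ρ`.
    | zero => exact fun x => ⟨0, fun y _ => by simpa using hρ y⟩
    | succ J ih =>
      intro x
      obtain ⟨p, hp⟩ := ih (x + h)
      obtain ⟨p', hp'⟩ := exists_center_steklovDot hf hh x (p := p) (by
        rw [show x + 2 * h = x + h + h by ring]; exact hp)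
      rw [← hq] at hp'
      refine ⟨p', fun y hy => (hp' y hy).trans (le_of_eq ?_)⟩
      have : ∀ j : ℕ, q * (q ^ j * B (x + h + j * h)) = q ^ (j + 1) * B (x + (j + 1 : ℕ) * h) := by
        intro j
        rw [show x + h + j * h = x + (j + 1 : ℕ) * h by push_cast; ring]
        ring
      rw [Finset.sum_range_succ', mul_add, Finset.mul_sum]
      simp only [this, pow_zero, Nat.cast_zero, zero_mul, add_zero, one_mul, B]
      ring
  obtain ⟨p, hp⟩ := key J x
  refine ⟨p, fun y hy => (hp y hy).trans ?_⟩
  refine add_le_add (Finset.sum_le_sum fun j hj => ?_) le_rfl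
  rw [mul_assoc]
  refine mul_le_mul_of_nonneg_left ?_ (pow_nonneg hq0 j)
  have h1 := integral_norm_le_absAvg hint (a := x + j * h) (b := x + j * h + 2 * h) (x := x)
    (H := 2 * (j + 2) * h) (by linarith) (by nlinarith [(Nat.cast_nonneg j : (0 : ℝ) ≤ j)])
    (by linarith) (by positivity)
  rw [show 2 * Real.exp 1 * ((j : ℝ) + 2) * absAvg (2 * (j + 2) * h) (f - steklovDot h f) x =
    Real.exp 1 * (2 * (j + 2) * absAvg (2 * (j + 2) * h) (f - steklovDot h f) x) by ring]
  refine mul_le_mul_of_nonneg_left ?_ (Real.exp_pos 1).le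
  rw [inv_mul_le_iff₀ hh]
  linarith

namespace PeriodicBanachLattice

variable {X : PeriodicBanachLattice}

/-- Differences of a Steklov average are controlled by the deviation from the average. -/
lemma norm_steklovDot_shift_sub_le {M : ℝ} (hM : X.SteklovBound M) :
    ∃ C, 0 ≤ C ∧ ∀ h > 0, ∀ f ∈ X.carrier, Continuous f →
      (fun x => steklovDot h f (x + h) - steklovDot h f x) ∈ X.carrier ∧
      X.norm (fun x => steklovDot h f (x + h) - steklovDot h f x) ≤
        C * X.norm (f - steklovDot h f) := by
  set q := 1 - Real.exp (-1) with hq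
  have hq0 : 0 ≤ q := by
    have : Real.exp (-1) ≤ 1 := Real.exp_le_one_iff.2 (by norm_num)
    linarith
  have hq1 : q < 1 := by linarith [Real.exp_pos (-1)]
  set a : ℕ → ℝ := fun j => 2 * (q ^ j * (2 * Real.exp 1 * (j + 2))) with ha
  have ha0 : ∀ j, 0 ≤ a j := fun j => by positivity
  have hsum : Summable a := by
    have h1 : Summable fun j : ℕ => (j : ℝ) ^ 1 * q ^ j :=
      summable_pow_mul_geometric_of_norm_lt_one 1 (by rwa [Real.norm_eq_abs, abs_of_nonneg hq0])
    have h2 : Summable fun j : ℕ => q ^ j := summable_geometric_of_lt_one hq0 hq1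
    refine ((h1.mul_left (4 * Real.exp 1)).add (h2.mul_left (8 * Real.exp 1))).congr fun j => ?_
    simp only [ha]
    ring
  refine ⟨(∑' j, a j) * M, mul_nonneg (tsum_nonneg ha0) hM.1, fun h hh f hf hfc => ?_⟩
  set c := steklovDot h f
  have hcX := (steklovDot_bound hM hh hf).1
  have hcp : Function.Periodic c (2 * Real.pi) := X.periodic _ hcX
  have hcc : Continuous c := continuous_steklovDot (X.intervalIntegrable hf) h
  obtain ⟨ρ, hρ⟩ : ∃ ρ, ∀ t, ‖c t‖ ≤ ρ := by
    obtain ⟨ρ, hρ⟩ := hcp.isBounded_of_continuous (by positivity) hcc |>.exists_norm_le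
    exact ⟨ρ, fun t => hρ _ (mem_range_self t)⟩
  have hρ0 : 0 ≤ ρ := (_root_.norm_nonneg _).trans (hρ 0)
  have key : ∀ J : ℕ, (fun x => c (x + h) - c x) ∈ X.carrier ∧
      X.norm (fun x => c (x + h) - c x) ≤
        (∑ j ∈ Finset.range J, a j) * M * X.norm (f - c) +
          2 * (q ^ J * ρ) * X.norm (fun _ => 1) := by
    intro J
    refine norm_le_of_absAvg hM (X.carrier.sub_mem hf hcX) (fun x => ?_)
      (by fun_prop : Continuous fun x => c (x + h) - c x).aestronglyMeasurable
      (Finset.range J) a (fun j => 2 * (j + 2) * h) (fun j _ => ha0 j)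
      (fun j _ => by positivity) (by positivity) (fun x => ?_)
    · rw [hcp x, show x + 2 * Real.pi + h = x + h + 2 * Real.pi by ring, hcp]
    · obtain ⟨p, hp⟩ := exists_center_steklovDot_iterate hfc hh hρ J x
      have h1 := hp x ⟨le_rfl, by linarith⟩
      have h2 := hp (x + h) ⟨by linarith, le_rfl⟩
      rw [show c (x + h) - c x = (c (x + h) - p) - (c x - p) by ring]
      refine (_root_.norm_sub_le _ _).trans ((add_le_add h2 h1).trans (le_of_eq ?_))
      have h3 : ∀ j : ℕ, a j * absAvg (2 * (j + 2) * h) (f - c) x =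
          2 * (q ^ j * (2 * Real.exp 1 * (j + 2)) * absAvg (2 * (j + 2) * h) (f - c) x) := by
        intro j; simp only [ha]; ring
      rw [Finset.sum_congr rfl fun j _ => h3 j, ← Finset.mul_sum]
      ring
  refine ⟨(key 0).1, ?_⟩
  -- As `J → ∞` the term with `ρ`, which is not controlled by `f - c`, disappears.
  have hlim : Filter.Tendsto (fun J : ℕ => (∑' j, a j) * M * X.norm (f - c) +
          2 * (q ^ J * ρ) * X.norm (fun _ => 1)) Filter.atTop
      (nhds ((∑' j, a j) * M * X.norm (f - c) + 2 * (0 * ρ) * X.norm (fun _ => 1))) :=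
    (((tendsto_pow_atTop_nhds_zero_of_lt_one hq0 hq1).mul_const ρ).const_mul 2
      |>.mul_const _).const_add _
  rw [zero_mul, mul_zero, zero_mul, add_zero] at hlim
  refine ge_of_tendsto' hlim fun J => (key J).2.trans ?_
  have := X.norm_nonneg _ (X.carrier.sub_mem hf hcX)
  have h0 := hM.1
  gcongr
  exact hsum.sum_le_tsum _ fun j _ => ha0 j

end PeriodicBanachLattice

/-! ### Trigonometric polynomials and their stability under the operators in use. -/

/-- The trigonometric monomial `x ↦ e^{ikx}`. -/
def trigMonomial (k : ℤ) (x : ℝ) : ℂ := Complex.exp (Complex.I * (k : ℂ) * (x : ℂ))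

lemma trigMonomial_add_index (k l : ℤ) (x : ℝ) :
    trigMonomial (k + l) x = trigMonomial k x * trigMonomial l x := by
  simp only [trigMonomial, ← Complex.exp_add]
  congr 1
  push_cast
  ring

lemma trigMonomial_add (k : ℤ) (x y : ℝ) :
    trigMonomial k (x + y) = trigMonomial k x * trigMonomial k y := by
  simp only [trigMonomial, ← Complex.exp_add]
  congr 1
  push_cast
  ring

lemma norm_trigMonomial (k : ℤ) (x : ℝ) : ‖trigMonomial k x‖ = 1 := by
  rw [trigMonomial, show Complex.I * (k : ℂ) * (x : ℂ) = ((k * x : ℝ) : ℂ) * Complex.I by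
    push_cast; ring]
  exact Complex.norm_exp_ofReal_mul_I _

lemma contDiff_trigMonomial (k : ℤ) (m : WithTop ℕ∞) : ContDiff ℝ m (trigMonomial k) := by
  unfold trigMonomial
  exact Complex.contDiff_exp.comp (contDiff_const.mul Complex.ofRealCLM.contDiff)

@[fun_prop]
lemma continuous_trigMonomial (k : ℤ) : Continuous (trigMonomial k) :=
  (contDiff_trigMonomial k 0).continuous

lemma hasDerivAt_trigMonomial (k : ℤ) (x : ℝ) :
    HasDerivAt (trigMonomial k) (Complex.I * k * trigMonomial k x) x := by
  have h1 : HasDerivAt (fun x : ℝ => Complex.I * (k : ℂ) * (x : ℂ)) (Complex.I * k * 1) x :=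
    (Complex.ofRealCLM.hasDerivAt (x := x)).const_mul _
  refine h1.cexp.congr_deriv ?_
  rw [trigMonomial]
  ring

lemma trigMonomial_periodic (k : ℤ) : Function.Periodic (trigMonomial k) (2 * Real.pi) := by
  intro x
  rw [trigMonomial_add]
  have : trigMonomial k (2 * Real.pi) = 1 := by
    rw [trigMonomial, Complex.exp_eq_one_iff]
    exact ⟨k, by push_cast; ring⟩
  rw [this, mul_one]

lemma integral_trigMonomial (k : ℤ) :
    ∫ t in (-Real.pi)..Real.pi, trigMonomial k t = if k = 0 then 2 * (Real.pi : ℂ) else 0 := by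
  split_ifs with hk
  · subst hk
    simp [trigMonomial]
    ring
  · have hc : Complex.I * (k : ℂ) ≠ 0 := mul_ne_zero Complex.I_ne_zero (by exact_mod_cast hk)
    have h1 := integral_exp_mul_complex (a := -Real.pi) (b := Real.pi) hc
    have h2 := trigMonomial_periodic k (-Real.pi)
    rw [show -Real.pi + 2 * Real.pi = Real.pi by ring] at h2
    simp only [trigMonomial] at h2 ⊢
    rw [h1, h2, sub_self, zero_div]

/-- The trigonometric polynomials of degree at most `n` as a subspace. -/
def trigSubmodule (n : ℕ) : Submodule ℂ (ℝ → ℂ) where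
  carrier := trigPoly n
  zero_mem' := ⟨0, by funext x; simp⟩
  add_mem' := by
    rintro _ _ ⟨c, rfl⟩ ⟨d, rfl⟩
    exact ⟨c + d, by funext x; simp [add_mul, Finset.sum_add_distrib]⟩
  smul_mem' := by
    rintro a _ ⟨c, rfl⟩
    exact ⟨a • c, by funext x; simp [mul_assoc, Finset.mul_sum]⟩

lemma trigMonomial_mem {n : ℕ} {k : ℤ} (hk : k ∈ Finset.Icc (-(n : ℤ)) n) :
    trigMonomial k ∈ trigSubmodule n := by
  refine ⟨fun j => if j = k then 1 else 0, ?_⟩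
  funext x
  simp only [ite_mul, one_mul, zero_mul, Finset.sum_ite_eq', if_pos hk, trigMonomial]

lemma mem_trigSubmodule_iff {n : ℕ} {T : ℝ → ℂ} : T ∈ trigSubmodule n ↔
    ∃ c : ℤ → ℂ, T = ∑ k ∈ Finset.Icc (-(n : ℤ)) n, c k • trigMonomial k := by
  have : ∀ c : ℤ → ℂ, (∑ k ∈ Finset.Icc (-(n : ℤ)) n, c k • trigMonomial k) = fun x : ℝ =>
    ∑ k ∈ Finset.Icc (-(n : ℤ)) (n : ℤ), c k * Complex.exp (Complex.I * (k : ℂ) * (x : ℂ)) := by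
    intro c
    funext x
    simp [trigMonomial]
  simp only [this]
  rfl

lemma trig_induction {n : ℕ} {p : (ℝ → ℂ) → Prop} (h0 : p 0)
    (hadd : ∀ S ∈ trigSubmodule n, ∀ T ∈ trigSubmodule n, p S → p T → p (S + T))
    (hsmul : ∀ (c : ℂ), ∀ k ∈ Finset.Icc (-(n : ℤ)) n, p (c • trigMonomial k))
    {T : ℝ → ℂ} (hT : T ∈ trigSubmodule n) : p T := by
  classical
  obtain ⟨c, rfl⟩ := mem_trigSubmodule_iff.1 hT
  suffices h : ∀ s ⊆ Finset.Icc (-(n : ℤ)) n, p (∑ k ∈ s, c k • trigMonomial k) from h _ subset_rfl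
  intro s
  induction s using Finset.induction_on with
  | empty => intro; simpa using h0
  | insert a s ha ih =>
    intro hs
    rw [Finset.sum_insert ha]
    have h1 := hs (Finset.mem_insert_self a s)
    have h2 : s ⊆ _ := (Finset.subset_insert a s).trans hs
    exact hadd _ (Submodule.smul_mem _ _ (trigMonomial_mem h1)) _
      (Submodule.sum_mem _ fun k hk => Submodule.smul_mem _ _ (trigMonomial_mem (h2 hk)))
      (hsmul _ _ h1) (ih h2)

lemma trig_contDiff {n : ℕ} {T : ℝ → ℂ} (hT : T ∈ trigSubmodule n) (m : WithTop ℕ∞) :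
    ContDiff ℝ m T :=
  trig_induction (p := fun T => ContDiff ℝ m T) contDiff_const (fun _ _ _ _ h1 h2 => h1.add h2)
    (fun _ k _ => contDiff_const.smul (contDiff_trigMonomial k m)) hT

lemma trig_continuous {n : ℕ} {T : ℝ → ℂ} (hT : T ∈ trigSubmodule n) : Continuous T :=
  (trig_contDiff hT 0).continuous

lemma trig_intervalIntegrable {n : ℕ} {T : ℝ → ℂ} (hT : T ∈ trigSubmodule n) (a b : ℝ) :
    IntervalIntegrable T volume a b := (trig_continuous hT).intervalIntegrable a b

lemma trig_differentiableAt {n : ℕ} {T : ℝ → ℂ} (hT : T ∈ trigSubmodule n) (x : ℝ) :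
    DifferentiableAt ℝ T x :=
  ((trig_contDiff hT 1).differentiable one_ne_zero) x

lemma trig_periodic {n : ℕ} {T : ℝ → ℂ} (hT : T ∈ trigSubmodule n) :
    Function.Periodic T (2 * Real.pi) :=
  trig_induction (p := fun T => Function.Periodic T (2 * Real.pi)) (fun _ => rfl)
    (fun _ _ _ _ h1 h2 => h1.add h2)
    (fun c k _ => (trigMonomial_periodic k).smul c) hT

lemma trig_deriv_mem {n : ℕ} {T : ℝ → ℂ} (hT : T ∈ trigSubmodule n) :
    deriv T ∈ trigSubmodule n := by
  refine trig_induction (p := fun T => deriv T ∈ trigSubmodule n) ?_ ?_ ?_ hT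
  · have : deriv (0 : ℝ → ℂ) = 0 := by funext x; simp
    rw [this]
    exact Submodule.zero_mem _
  · intro S hS T hT h1 h2
    have : deriv (S + T) = deriv S + deriv T := by
      funext x
      exact deriv_add (trig_differentiableAt hS x) (trig_differentiableAt hT x)
    rw [this]
    exact Submodule.add_mem _ h1 h2
  · intro c k hk
    have : deriv (c • trigMonomial k) = (c * (Complex.I * k)) • trigMonomial k := by
      funext x
      rw [((hasDerivAt_trigMonomial k x).const_smul c).deriv]
      simp [mul_assoc]
    rw [this]
    exact Submodule.smul_mem _ _ (trigMonomial_mem hk)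

lemma steklov_trigMonomial (h : ℝ) (k : ℤ) :
    steklov h (trigMonomial k) = steklov h (trigMonomial k) 0 • trigMonomial k := by
  funext x
  have h1 := intervalIntegral.integral_comp_add_left (a := -(h / 2)) (b := h / 2)
    (trigMonomial k) x
  simp only [steklov, Pi.smul_apply, smul_eq_mul]
  rw [sub_eq_add_neg, ← h1]
  simp only [trigMonomial_add, intervalIntegral.integral_const_mul, zero_sub, zero_add]
  ring

lemma trig_steklov_mem {n : ℕ} {T : ℝ → ℂ} (hT : T ∈ trigSubmodule n) (h : ℝ) :
    steklov h T ∈ trigSubmodule n := by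
  refine trig_induction (p := fun T => steklov h T ∈ trigSubmodule n) ?_ ?_ ?_ hT
  · have : steklov h 0 = 0 := by funext x; simp [steklov]
    rw [this]
    exact Submodule.zero_mem _
  · intro S hS T hT h1 h2
    have : steklov h (S + T) = steklov h S + steklov h T := by
      funext x
      simp only [steklov, Pi.add_apply]
      rw [intervalIntegral.integral_add (trig_intervalIntegrable hS _ _)
        (trig_intervalIntegrable hT _ _), mul_add]
    rw [this]
    exact Submodule.add_mem _ h1 h2
  · intro c k hk
    rw [PeriodicBanachLattice.steklov_smul, steklov_trigMonomial]
    exact Submodule.smul_mem _ _ (Submodule.smul_mem _ _ (trigMonomial_mem hk))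

lemma trig_comp_add_mem {n : ℕ} {T : ℝ → ℂ} (hT : T ∈ trigSubmodule n) (a : ℝ) :
    (fun x => T (x + a)) ∈ trigSubmodule n := by
  refine trig_induction (p := fun T => (fun x => T (x + a)) ∈ trigSubmodule n)
    (Submodule.zero_mem _) (fun S _ T _ h1 h2 => Submodule.add_mem _ h1 h2) ?_ hT
  intro c k hk
  have : (fun x => (c • trigMonomial k) (x + a)) =
      (c * trigMonomial k a) • trigMonomial k := by
    funext x
    simp only [Pi.smul_apply, smul_eq_mul, trigMonomial_add]
    ring
  rw [this]
  exact Submodule.smul_mem _ _ (trigMonomial_mem hk)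

lemma trig_steklovDot_mem {n : ℕ} {T : ℝ → ℂ} (hT : T ∈ trigSubmodule n) (h : ℝ) :
    steklovDot h T ∈ trigSubmodule n :=
  trig_comp_add_mem (trig_steklov_mem hT h) (h / 2)

lemma steklovDot_deriv {f : ℝ → ℂ} (hf : ContDiff ℝ 1 f) (h : ℝ) :
    steklovDot h (deriv f) = deriv (steklovDot h f) := by
  funext x
  rw [(hasDerivAt_steklovDot hf.continuous h x).deriv, steklovDot_eq,
    integral_deriv_eq_sub (fun y _ => hf.differentiable one_ne_zero y)
      ((hf.continuous_deriv le_rfl).intervalIntegrable _ _)]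

lemma steklov_deriv {f : ℝ → ℂ} (hf : ContDiff ℝ 1 f) (h : ℝ) :
    steklov h (deriv f) = deriv (steklov h f) := by
  funext x
  have h1 : steklov h f = fun x => steklovDot h f (x - h / 2) := funext (steklov_eq_steklovDot h f)
  rw [h1, deriv_comp_sub_const, steklov_eq_steklovDot, steklovDot_deriv hf]

/-! ### Dirichlet sums -/

/-- The sum of `N` consecutive trigonometric monomials, starting at index `a`. -/
def dirichletSum (a : ℤ) (N : ℕ) (t : ℝ) : ℂ := ∑ i ∈ Finset.range N, trigMonomial (a + i) t

@[fun_prop]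
lemma continuous_dirichletSum (a : ℤ) (N : ℕ) : Continuous (dirichletSum a N) := by
  unfold dirichletSum
  fun_prop

lemma norm_dirichletSum_le (a : ℤ) (N : ℕ) (t : ℝ) : ‖dirichletSum a N t‖ ≤ N := by
  refine (norm_sum_le _ _).trans ?_
  simp [norm_trigMonomial]

/-- Multiplication by `e^{it} - 1` telescopes the sum to two terms, and `|e^{it} - 1| ≥ 2 |t| / π`
on `[-π, π]`. -/
lemma abs_mul_norm_dirichletSum_le (a : ℤ) (N : ℕ) {t : ℝ} (ht : |t| ≤ Real.pi) :
    |t| * ‖dirichletSum a N t‖ ≤ Real.pi := by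
  have h1 : (trigMonomial 1 t - 1) * dirichletSum a N t =
      trigMonomial (a + N) t - trigMonomial a t := by
    rw [dirichletSum, Finset.mul_sum]
    have : ∀ i : ℕ, (trigMonomial 1 t - 1) * trigMonomial (a + i) t =
        trigMonomial (a + (i + 1 : ℕ)) t - trigMonomial (a + i) t := by
      intro i
      rw [show a + ((i + 1 : ℕ) : ℤ) = 1 + (a + i) by push_cast; ring,
        trigMonomial_add_index 1]
      ring
    rw [Finset.sum_congr rfl fun i _ => this i,
      Finset.sum_range_sub (fun i : ℕ => trigMonomial (a + i) t)]
    simp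
  have h2 : ‖trigMonomial (a + N) t - trigMonomial a t‖ ≤ 2 := by
    refine (norm_sub_le _ _).trans ?_
    rw [norm_trigMonomial, norm_trigMonomial]
    norm_num
  have h3 : 2 * |t| / Real.pi ≤ ‖trigMonomial 1 t - 1‖ := by
    have h4 : ‖trigMonomial 1 t - 1‖ = ‖2 * Real.sin (t / 2)‖ := by
      rw [← Complex.norm_exp_I_mul_ofReal_sub_one]
      simp [trigMonomial]
    rw [h4, norm_mul, Real.norm_eq_abs, Real.norm_eq_abs, abs_two]
    have h5 := Real.mul_abs_le_abs_sin (x := t / 2) (by rw [abs_div, abs_two]; linarith)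
    rw [abs_div, abs_two] at h5
    calc 2 * |t| / Real.pi = 2 * (2 / Real.pi * (|t| / 2)) := by ring
      _ ≤ _ := by gcongr
  rw [← h1, norm_mul] at h2
  have h6 := (mul_le_mul_of_nonneg_right h3 (norm_nonneg (dirichletSum a N t))).trans h2
  have hpi := Real.pi_pos
  rw [div_mul_eq_mul_div, div_le_iff₀ hpi] at h6
  linarith

/-- On this interval every summand is within `1/2` of `1`, so nothing cancels. It bounds the mass of
the Jackson kernel from below. -/
lemma half_le_norm_dirichletSum {N : ℕ} (hN : 1 ≤ N) {t : ℝ} (ht : |t| ≤ 1 / (2 * N)) :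
    (N : ℝ) / 2 ≤ ‖dirichletSum 0 N t‖ := by
  have hN' : (1 : ℝ) ≤ N := by exact_mod_cast hN
  have h1 : ‖dirichletSum 0 N t - N‖ ≤ N / 2 := by
    have : dirichletSum 0 N t - N = ∑ i ∈ Finset.range N, (trigMonomial i t - 1) := by
      simp [dirichletSum]
    rw [this]
    refine (norm_sum_le _ _).trans ?_
    calc ∑ i ∈ Finset.range N, ‖trigMonomial i t - 1‖ ≤ ∑ i ∈ Finset.range N, (1 / 2 : ℝ) := by
          refine Finset.sum_le_sum fun i hi => ?_
          have h2 := Real.norm_exp_I_mul_ofReal_sub_one_le (x := i * t)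
          have h3 : trigMonomial i t = Complex.exp (Complex.I * ((i * t : ℝ) : ℂ)) := by
            rw [trigMonomial]
            congr 1
            push_cast
            ring
          rw [h3]
          refine h2.trans ?_
          have h4 : (i : ℝ) ≤ N := by exact_mod_cast (Finset.mem_range.1 hi).le
          rw [Real.norm_eq_abs, abs_mul, Nat.abs_cast]
          calc (i : ℝ) * |t| ≤ N * (1 / (2 * N)) := by gcongr
            _ = 1 / 2 := by field_simp
      _ = N / 2 := by simp; ring
  have h2 := norm_sub_norm_le (N : ℂ) (N - dirichletSum 0 N t)
  rw [sub_sub_cancel, norm_sub_rev (N : ℂ)] at h2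
  have h3 : ‖(N : ℂ)‖ = N := by simp
  linarith

/-! ### Kernels with polynomial decay -/

/-- A dyadic combination of averages of `‖g‖` at the scales `2 ^ j / n`. -/
def dyadicAvg (n : ℕ) (g : ℝ → ℂ) (x : ℝ) : ℝ :=
  ∑ j ∈ Finset.range (n + 3), (1 / 2 : ℝ) ^ j * absAvg (2 * (2 ^ j / n)) g x

/-- The outermost of the `n + 3` dyadic layers, of radius `2^{n+2} / n`, already covers `[-π, π]`.
-/
lemma pi_mul_le_two_pow (n : ℕ) : n * Real.pi ≤ 2 ^ (n + 2) := by
  have h1 : (n : ℝ) ≤ 2 ^ n := by exact_mod_cast (Nat.lt_two_pow_self (n := n)).le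
  have h2 := Real.pi_le_four
  calc n * Real.pi ≤ 2 ^ n * 4 := by gcongr
    _ = 2 ^ (n + 2) := by ring

/-- Layer-cake bound for a quantity `κ ≤ K` with `κ |τ|^p ≤ K`. -/
lemma le_sum_dyadic_layers {κ K τ : ℝ} {p J : ℕ} (h0 : 0 ≤ K) (h1 : κ ≤ K)
    (h2 : κ * |τ| ^ p ≤ K) (hJ : |τ| ≤ 2 ^ J) :
    κ ≤ ∑ j ∈ Finset.range (J + 1), if |τ| ≤ 2 ^ j then 2 ^ p * K * ((2 ^ p)⁻¹) ^ j else 0 := by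
  classical
  have hex : ∃ j : ℕ, |τ| ≤ 2 ^ j := ⟨J, hJ⟩
  -- The least layer containing `τ`: if `i > 0`, then `|τ| > 2^{i-1}`, and the decay hypothesis
  -- bounds `κ` by the `i`-th summand alone.
  set i := Nat.find hex with hi
  have hi1 : |τ| ≤ 2 ^ i := Nat.find_spec hex
  have hiJ : i ≤ J := Nat.find_min' hex hJ
  have h3 : κ ≤ 2 ^ p * K * ((2 ^ p)⁻¹) ^ i := by
    rcases Nat.eq_zero_or_pos i with h | h
    · rw [h, pow_zero, mul_one]
      refine h1.trans (le_mul_of_one_le_left h0 (one_le_pow₀ (by norm_num)))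
    · obtain ⟨l, hl⟩ : ∃ l, i = l + 1 := ⟨i - 1, by omega⟩
      have hlt : (2 : ℝ) ^ l < |τ| := by
        have := Nat.find_min hex (m := l) (by omega)
        exact not_le.1 this
      rw [hl, pow_succ]
      by_cases hκ : κ ≤ 0
      · exact hκ.trans (by positivity)
      · push Not at hκ
        have h4 : κ * (2 ^ l) ^ p ≤ K := le_trans (by gcongr) h2
        have h5 : ((2 : ℝ) ^ p)⁻¹ ^ l * (2 ^ l) ^ p = 1 := by
          rw [inv_pow, ← pow_mul, ← pow_mul, mul_comm l p]
          exact inv_mul_cancel₀ (by positivity)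
        have h6 : (2 : ℝ) ^ p * K * (((2 ^ p)⁻¹) ^ l * (2 ^ p)⁻¹) = K * ((2 : ℝ) ^ p)⁻¹ ^ l := by
          field_simp
        rw [h6]
        calc κ = (κ * (2 ^ l) ^ p) * ((2 : ℝ) ^ p)⁻¹ ^ l := by
              rw [mul_assoc, mul_comm ((2 ^ l) ^ p), h5, mul_one]
          _ ≤ _ := by gcongr
  refine h3.trans ?_
  have h7 := Finset.single_le_sum
    (f := fun j => if |τ| ≤ 2 ^ j then 2 ^ p * K * ((2 ^ p)⁻¹) ^ j else 0)
    (fun j _ => by split_ifs <;> positivity)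
    (Finset.mem_range.2 (Nat.lt_succ_of_le hiJ))
  simpa [hi1] using h7

/-- Dominate the kernel by a sum of multiples of indicators of `|t| ≤ 2^j / n` and integrate term by
term; since `φ ≥ 0`, layers reaching beyond `[-π, π]` do no harm. -/
lemma integral_kernel_mul_le {k φ : ℝ → ℝ} (hk : Continuous k) (hφ0 : ∀ t, 0 ≤ φ t)
    (hφ : ∀ a b, IntervalIntegrable φ volume a b) {n p : ℕ} (hn : 1 ≤ n) {K : ℝ} (hK : 0 ≤ K)
    (h1 : ∀ t, |t| ≤ Real.pi → k t ≤ K) (h2 : ∀ t, |t| ≤ Real.pi → k t * |n * t| ^ p ≤ K) :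
    ∫ t in (-Real.pi)..Real.pi, k t * φ t ≤ ∑ j ∈ Finset.range (n + 3),
      2 ^ p * K * ((2 ^ p)⁻¹) ^ j * ∫ t in (-(2 ^ j / n : ℝ))..(2 ^ j / n), φ t := by
  have hn0 : (0 : ℝ) < n := by exact_mod_cast hn
  have hpi := Real.pi_pos
  set S : ℕ → Set ℝ := fun j => Icc (-(2 ^ j / n : ℝ)) (2 ^ j / n)
  set c : ℕ → ℝ := fun j => 2 ^ p * K * ((2 ^ p)⁻¹) ^ j with hc
  have hc0 : ∀ j, 0 ≤ c j := fun j => by positivity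
  have hi : ∀ j, IntervalIntegrable (fun t => c j * (S j).indicator φ t) volume
      (-Real.pi) Real.pi := by
    intro j
    refine IntervalIntegrable.const_mul ?_ _
    have h3 := hφ (-Real.pi) Real.pi
    rw [intervalIntegrable_iff] at h3 ⊢
    exact h3.indicator measurableSet_Icc
  have hpt : ∀ t ∈ Icc (-Real.pi) Real.pi,
      k t * φ t ≤ ∑ j ∈ Finset.range (n + 3), c j * (S j).indicator φ t := by
    intro t ht
    have ht' : |t| ≤ Real.pi := abs_le.2 ht
    have hτ : |(n : ℝ) * t| ≤ 2 ^ (n + 2) := by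
      rw [abs_mul, Nat.abs_cast]
      exact le_trans (by gcongr) (pi_mul_le_two_pow n)
    have h3 := le_sum_dyadic_layers hK (h1 t ht') (h2 t ht') hτ
    refine (mul_le_mul_of_nonneg_right h3 (hφ0 t)).trans (le_of_eq ?_)
    rw [Finset.sum_mul]
    refine Finset.sum_congr rfl fun j _ => ?_
    have h4 : |(n : ℝ) * t| ≤ 2 ^ j ↔ t ∈ S j := by
      rw [abs_mul, Nat.abs_cast, mem_Icc, ← abs_le, le_div_iff₀ hn0, mul_comm]
    by_cases h : t ∈ S j
    · rw [if_pos (h4.2 h), indicator_of_mem h]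
    · rw [if_neg (mt h4.1 h), indicator_of_notMem h, zero_mul, mul_zero]
  have h5 := integral_mono_on (by linarith)
    ((hφ (-Real.pi) Real.pi).continuousOn_mul hk.continuousOn)
    (IntervalIntegrable.sum (Finset.range (n + 3)) fun j _ => hi j)
    (fun t ht => by simpa only [Finset.sum_apply] using hpt t ht)
  refine h5.trans ?_
  simp only [Finset.sum_apply]
  rw [intervalIntegral.integral_finsetSum fun j _ => hi j]
  refine Finset.sum_le_sum fun j _ => ?_
  rw [intervalIntegral.integral_const_mul]
  refine mul_le_mul_of_nonneg_left ?_ (hc0 j)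
  have hR : (-(2 ^ j / n : ℝ)) ≤ 2 ^ j / n := by
    have : (0 : ℝ) ≤ 2 ^ j / n := by positivity
    linarith
  rw [integral_of_le (by linarith), integral_of_le hR, setIntegral_indicator measurableSet_Icc,
    ← integral_Icc_eq_integral_Ioc (x := -(2 ^ j / n : ℝ))]
  refine setIntegral_mono_set ?_ (Filter.Eventually.of_forall fun t => hφ0 t)
    (LE.le.eventuallyLE inter_subset_right)
  rw [integrableOn_Icc_iff_integrableOn_Ioc]
  exact (intervalIntegrable_iff_integrableOn_Ioc_of_le hR).1 (hφ _ _)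

lemma integral_comp_add_symm {E : Type*} [NormedAddCommGroup E] [NormedSpace ℝ E] (φ : ℝ → E)
    (x R : ℝ) : ∫ t in (-R)..R, φ (x + t) = ∫ t in (x - R)..(x + R), φ t := by
  rw [intervalIntegral.integral_comp_add_left, sub_eq_add_neg]

/-- Quadratic decay gives layer weights `4^{-j}`; passing from integrals to averages costs the
window length, proportional to `2^j`, and the summable weights `2^{-j}` remain. -/
lemma norm_integral_kernel_mul_le {k : ℝ → ℂ} (hk : Continuous k) {f : ℝ → ℂ}
    (hf : ∀ a b, IntervalIntegrable f volume a b) {n : ℕ} (hn : 1 ≤ n) {K : ℝ} (hK : 0 ≤ K)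
    (h1 : ∀ t, |t| ≤ Real.pi → ‖k t‖ ≤ K * n)
    (h2 : ∀ t, |t| ≤ Real.pi → ‖k t‖ * |n * t| ^ 2 ≤ K * n) (x : ℝ) :
    ‖∫ t in (-Real.pi)..Real.pi, k t * f (x + t)‖ ≤ 8 * K * dyadicAvg n f x := by
  have hn0 : (0 : ℝ) < n := by exact_mod_cast hn
  have hpi := Real.pi_pos
  have hfx : ∀ a b, IntervalIntegrable (fun t => ‖f (x + t)‖) volume a b := by
    intro a b
    have := (hf (x + a) (x + b)).norm.comp_add_left x
    simpa using this
  refine (intervalIntegral.norm_integral_le_integral_norm (by linarith)).trans ?_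
  simp only [norm_mul]
  refine (integral_kernel_mul_le hk.norm (fun t => norm_nonneg _) hfx hn (by positivity)
    h1 h2).trans (le_of_eq ?_)
  rw [dyadicAvg, Finset.mul_sum]
  refine Finset.sum_congr rfl fun j _ => ?_
  rw [integral_comp_add_symm (fun t => ‖f t‖), absAvg,
    show x - 2 * (2 ^ j / (n : ℝ)) / 2 = x - 2 ^ j / n by ring,
    show x + 2 * (2 ^ j / (n : ℝ)) / 2 = x + 2 ^ j / n by ring]
  have h4 : ((2 ^ 2 : ℝ)⁻¹) ^ j = (1 / 2) ^ j * (2 ^ j)⁻¹ := by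
    rw [show ((2 : ℝ) ^ 2)⁻¹ = 1 / 2 * 2⁻¹ by norm_num, mul_pow, inv_pow]
  rw [h4]
  field_simp
  ring

/-- Approximation by averages with a kernel of fast decay. -/
lemma norm_integral_kernel_mul_sub_le {k : ℝ → ℝ} (hk : Continuous k) (hk0 : ∀ t, 0 ≤ k t)
    (hk1 : ∫ t in (-Real.pi)..Real.pi, k t = 1) {F : ℝ → ℂ} (hF : ContDiff ℝ 1 F)
    {n : ℕ} (hn : 1 ≤ n) {K : ℝ} (hK : 0 ≤ K)
    (h1 : ∀ t, |t| ≤ Real.pi → k t ≤ K * n)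
    (h2 : ∀ t, |t| ≤ Real.pi → k t * |n * t| ^ 4 ≤ K * n) (x : ℝ) :
    ‖F x - ∫ t in (-Real.pi)..Real.pi, (k t : ℂ) * F (x + t)‖ ≤
      64 * K / n * dyadicAvg n (deriv F) x := by
  have hn0 : (0 : ℝ) < n := by exact_mod_cast hn
  have hpi := Real.pi_pos
  have hdc : Continuous (deriv F) := hF.continuous_deriv le_rfl
  have hdi : ∀ a b, IntervalIntegrable (fun t => ‖deriv F t‖) volume a b := fun a b =>
    hdc.norm.intervalIntegrable a b
  have hFc := hF.continuous
  have e1 : F x - ∫ t in (-Real.pi)..Real.pi, (k t : ℂ) * F (x + t) =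
      ∫ t in (-Real.pi)..Real.pi, (k t : ℂ) * (F x - F (x + t)) := by
    simp only [mul_sub]
    rw [intervalIntegral.integral_sub
      (Continuous.intervalIntegrable (by fun_prop) _ _)
      (Continuous.intervalIntegrable (by fun_prop) _ _), intervalIntegral.integral_mul_const,
      intervalIntegral.integral_ofReal, hk1, Complex.ofReal_one, one_mul]
  set φ : ℝ → ℝ := fun t => |∫ u in x..(x + t), ‖deriv F u‖| with hφ
  have hφc : Continuous φ :=
    ((continuous_primitive hdi x).comp (continuous_const.add continuous_id)).abs
  have e2 : ∀ t, ‖F x - F (x + t)‖ ≤ φ t := by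
    intro t
    rw [norm_sub_rev, ← integral_deriv_eq_sub (fun y _ => hF.differentiable one_ne_zero y)
      (hdc.intervalIntegrable _ _)]
    exact norm_integral_le_abs_integral_norm
  rw [e1]
  refine (intervalIntegral.norm_integral_le_integral_norm (by linarith)).trans ?_
  have e3 : ∫ t in (-Real.pi)..Real.pi, ‖(k t : ℂ) * (F x - F (x + t))‖ ≤
      ∫ t in (-Real.pi)..Real.pi, k t * φ t := by
    refine integral_mono_on (by linarith) (Continuous.intervalIntegrable (by fun_prop) _ _)
      (Continuous.intervalIntegrable (by fun_prop) _ _) fun t _ => ?_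
    rw [norm_mul, Complex.norm_real, Real.norm_eq_abs, abs_of_nonneg (hk0 t)]
    exact mul_le_mul_of_nonneg_left (e2 t) (hk0 t)
  refine e3.trans ((integral_kernel_mul_le hk (fun t => abs_nonneg _)
    (fun a b => hφc.intervalIntegrable a b) hn (by positivity) h1 h2).trans ?_)
  rw [dyadicAvg, Finset.mul_sum]
  refine Finset.sum_le_sum fun j _ => ?_
  set R : ℝ := 2 ^ j / n with hR
  have hR0 : 0 < R := by positivity
  have e4 : ∀ t ∈ Icc (-R) R, φ t ≤ 2 * R * absAvg (2 * R) (deriv F) x := by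
    intro t ht
    have hdi' : ∀ a b, IntervalIntegrable (deriv F) volume a b := fun a b =>
      hdc.intervalIntegrable a b
    simp only [hφ]
    rcases le_total 0 t with h | h
    · rw [abs_of_nonneg (integral_nonneg (by linarith) fun u _ => norm_nonneg _)]
      exact integral_norm_le_absAvg hdi' (by linarith) (by linarith) (by linarith [ht.2])
        (by linarith)
    · rw [integral_symm, abs_neg,
        abs_of_nonneg (integral_nonneg (by linarith) fun u _ => norm_nonneg _)]
      exact integral_norm_le_absAvg hdi' (by linarith) (by linarith [ht.1]) (by linarith)
        (by linarith)
  have e5 : ∫ t in (-R)..R, φ t ≤ 2 * R * (2 * R * absAvg (2 * R) (deriv F) x) := by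
    have := integral_mono_on (by linarith) (hφc.intervalIntegrable (-R) R)
      (intervalIntegrable_const (μ := volume)) e4
    rw [intervalIntegral.integral_const, smul_eq_mul] at this
    linarith
  -- Two factors `2^j` are lost, one from integrating `φ` over the layer and one from the increment
  -- of `F`; fourth-order decay leaves ample room.
  have h4 : ((2 ^ 4 : ℝ)⁻¹) ^ j * (2 ^ j * 2 ^ j) ≤ (1 / 2) ^ j := by
    rw [← mul_pow, ← mul_pow]
    exact pow_le_pow_left₀ (by norm_num) (by norm_num) j
  have hA : 0 ≤ absAvg (2 * R) (deriv F) x := absAvg_nonneg (by positivity) _ _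
  calc 2 ^ 4 * (K * n) * ((2 ^ 4 : ℝ)⁻¹) ^ j * ∫ t in (-R)..R, φ t
      ≤ 2 ^ 4 * (K * n) * ((2 ^ 4 : ℝ)⁻¹) ^ j * (2 * R * (2 * R * absAvg (2 * R) (deriv F) x)) := by
        gcongr
    _ = 64 * K / n * ((((2 ^ 4 : ℝ)⁻¹) ^ j * (2 ^ j * 2 ^ j)) * absAvg (2 * R) (deriv F) x) := by
        rw [hR]
        field_simp
        ring
    _ ≤ 64 * K / n * ((1 / 2) ^ j * absAvg (2 * R) (deriv F) x) := by gcongr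

/-! ### Reproducing kernels and the Bernstein inequality -/

lemma integral_dirichletSum_mul_trigMonomial (a b k : ℤ) (N L : ℕ) (x : ℝ) :
    ∫ t in (-Real.pi)..Real.pi, dirichletSum a N t * dirichletSum b L t * trigMonomial k (x + t) =
      2 * (Real.pi : ℂ) * trigMonomial k x * ∑ j ∈ Finset.range L, ∑ i ∈ Finset.range N,
        if a + i + (b + j) + k = 0 then (1 : ℂ) else 0 := by
  have h1 : ∀ t, dirichletSum a N t * dirichletSum b L t * trigMonomial k (x + t) =
      ∑ j ∈ Finset.range L, ∑ i ∈ Finset.range N,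
        trigMonomial k x * trigMonomial (a + i + (b + j) + k) t := by
    intro t
    rw [dirichletSum, dirichletSum, Finset.sum_mul_sum, Finset.sum_comm, Finset.sum_mul]
    refine Finset.sum_congr rfl fun j _ => ?_
    rw [Finset.sum_mul]
    refine Finset.sum_congr rfl fun i _ => ?_
    rw [trigMonomial_add, trigMonomial_add_index _ k, trigMonomial_add_index (a + i)]
    ring
  simp only [h1]
  rw [intervalIntegral.integral_finsetSum fun j _ =>
    Continuous.intervalIntegrable (by fun_prop) _ _, Finset.mul_sum]
  refine Finset.sum_congr rfl fun j _ => ?_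
  rw [intervalIntegral.integral_finsetSum fun i _ =>
    Continuous.intervalIntegrable (by fun_prop) _ _, Finset.mul_sum]
  refine Finset.sum_congr rfl fun i _ => ?_
  rw [intervalIntegral.integral_const_mul, integral_trigMonomial]
  split_ifs <;> ring

lemma sum_range_ite_eq_zero {a c : ℤ} {N : ℕ} :
    (∑ i ∈ Finset.range N, if a + i + c = 0 then (1 : ℂ) else 0) =
      if 0 ≤ -a - c ∧ -a - c < N then 1 else 0 := by
  split_ifs with h
  · rw [Finset.sum_eq_single (-a - c).toNat]
    · rw [if_pos]
      rw [Int.toNat_of_nonneg h.1]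
      ring
    · intro i _ hi
      rw [if_neg]
      intro h'
      apply hi
      omega
    · intro h'
      exact absurd (Finset.mem_range.2 (by omega)) h'
  · refine Finset.sum_eq_zero fun i hi => if_neg fun h' => h ?_
    have := Finset.mem_range.1 hi
    omega

/-- A de la Vallée Poussin type kernel: for `|k| ≤ n`, each of the `2n + 1` frequencies of the short
sum pairs with exactly one frequency of the long sum, so all multipliers equal `2n + 1`. The product
of two sums supplies the quadratic decay. -/
lemma integral_reproducing {n : ℕ} {T : ℝ → ℂ} (hT : T ∈ trigSubmodule n) (x : ℝ) :
    ∫ t in (-Real.pi)..Real.pi, dirichletSum (-(2 * n : ℤ)) (4 * n + 1) t *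
      dirichletSum (-(n : ℤ)) (2 * n + 1) t * T (x + t) = 2 * Real.pi * (2 * n + 1) * T x := by
  refine trig_induction (p := fun T => ∫ t in (-Real.pi)..Real.pi,
    dirichletSum (-(2 * n : ℤ)) (4 * n + 1) t * dirichletSum (-(n : ℤ)) (2 * n + 1) t * T (x + t) =
      2 * Real.pi * (2 * n + 1) * T x) (by simp) ?_ ?_ hT
  · intro S hS T hT h1 h2
    have hSc := trig_continuous hS
    have hTc := trig_continuous hT
    simp only [Pi.add_apply, mul_add]
    rw [intervalIntegral.integral_add (Continuous.intervalIntegrable (by fun_prop) _ _)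
      (Continuous.intervalIntegrable (by fun_prop) _ _), h1, h2]
    ring
  · intro c k hk
    simp only [Pi.smul_apply, smul_eq_mul, mul_left_comm _ c]
    rw [intervalIntegral.integral_const_mul, integral_dirichletSum_mul_trigMonomial]
    have hk' := Finset.mem_Icc.1 hk
    have : ∀ j ∈ Finset.range (2 * n + 1), (∑ i ∈ Finset.range (4 * n + 1),
        if -(2 * n : ℤ) + i + (-(n : ℤ) + j) + k = 0 then (1 : ℂ) else 0) = 1 := by
      intro j hj
      have := Finset.mem_range.1 hj
      simp only [add_assoc (-(2 * n : ℤ) + _)]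
      rw [sum_range_ite_eq_zero, if_pos]
      push_cast
      omega
    rw [Finset.sum_congr rfl this]
    simp only [Finset.sum_const, Finset.card_range, nsmul_eq_mul, mul_one]
    push_cast
    ring

/-- Starting one sum at index `0` makes the number of frequency pairs equal to `n + 1 - k`, affine
in `k`; the linear part is what differentiation produces. -/
lemma integral_derivative_kernel {n : ℕ} {T : ℝ → ℂ} (hT : T ∈ trigSubmodule n) (x : ℝ) :
    ∫ t in (-Real.pi)..Real.pi, dirichletSum 0 (2 * n + 1) t *
      dirichletSum (-(n : ℤ)) (2 * n + 1) t * T (x + t) =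
      2 * Real.pi * ((n + 1) * T x + Complex.I * deriv T x) := by
  refine trig_induction (p := fun T => ∫ t in (-Real.pi)..Real.pi,
    dirichletSum 0 (2 * n + 1) t * dirichletSum (-(n : ℤ)) (2 * n + 1) t * T (x + t) =
      2 * Real.pi * ((n + 1) * T x + Complex.I * deriv T x)) (by simp) ?_ ?_ hT
  · intro S hS T hT h1 h2
    have hSc := trig_continuous hS
    have hTc := trig_continuous hT
    have hd : deriv (S + T) x = deriv S x + deriv T x :=
      deriv_add (trig_differentiableAt hS x) (trig_differentiableAt hT x)
    rw [hd]
    simp only [Pi.add_apply, mul_add]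
    rw [intervalIntegral.integral_add (Continuous.intervalIntegrable (by fun_prop) _ _)
      (Continuous.intervalIntegrable (by fun_prop) _ _), h1, h2]
    ring
  · intro c k hk
    rw [((hasDerivAt_trigMonomial k x).const_smul c).deriv]
    simp only [Pi.smul_apply, smul_eq_mul, mul_left_comm _ c]
    rw [intervalIntegral.integral_const_mul, integral_dirichletSum_mul_trigMonomial]
    have hk' := Finset.mem_Icc.1 hk
    have : ∀ j ∈ Finset.range (2 * n + 1), (∑ i ∈ Finset.range (2 * n + 1),
        if (0 : ℤ) + i + (-(n : ℤ) + j) + k = 0 then (1 : ℂ) else 0) =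
          if j ∈ Finset.range (n + 1 - k).toNat then 1 else 0 := by
      intro j hj
      have := Finset.mem_range.1 hj
      simp only [add_assoc ((0 : ℤ) + _)]
      rw [sum_range_ite_eq_zero]
      refine if_congr ?_ rfl rfl
      rw [Finset.mem_range]
      push_cast
      omega
    rw [Finset.sum_congr rfl this, Finset.sum_ite_mem, Finset.inter_eq_right.2
      (Finset.range_subset_range.2 (by omega))]
    have h3 : (((n + 1 - k).toNat : ℕ) : ℂ) = n + 1 - k := by
      have h4 : (((n + 1 - k).toNat : ℕ) : ℤ) = n + 1 - k := Int.toNat_of_nonneg (by omega)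
      exact_mod_cast congrArg (Int.cast : ℤ → ℂ) h4
    simp only [Finset.sum_const, Finset.card_range, nsmul_eq_mul, h3, mul_one]
    have hI := Complex.I_mul_I
    linear_combination (-2 * c * Real.pi * trigMonomial k x * k) * hI

lemma norm_dirichletSum_mul_le (a b : ℤ) {N L n : ℕ} (hN : N ≤ 5 * n) (hL : L ≤ 3 * n) (t : ℝ) :
    ‖dirichletSum a N t * dirichletSum b L t‖ ≤ 15 * n * n := by
  rw [norm_mul]
  have h1 : (N : ℝ) ≤ 5 * n := by exact_mod_cast hN
  have h2 : (L : ℝ) ≤ 3 * n := by exact_mod_cast hL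
  calc _ ≤ (5 * n : ℝ) * (3 * n) := mul_le_mul ((norm_dirichletSum_le a N t).trans h1)
        ((norm_dirichletSum_le b L t).trans h2) (norm_nonneg _) (by positivity)
    _ = _ := by ring

lemma norm_dirichletSum_mul_sq_le (a b : ℤ) (N L n : ℕ) {t : ℝ} (ht : |t| ≤ Real.pi) :
    ‖dirichletSum a N t * dirichletSum b L t‖ * |n * t| ^ 2 ≤ 16 * n * n := by
  rw [norm_mul, abs_mul, Nat.abs_cast]
  have h1 := abs_mul_norm_dirichletSum_le a N ht
  have h2 := abs_mul_norm_dirichletSum_le b L ht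
  have h3 := mul_le_mul h1 h2 (by positivity) Real.pi_pos.le
  have h4 := Real.pi_le_four
  have h5 : Real.pi * Real.pi ≤ 16 := by nlinarith [Real.pi_pos]
  calc _ = (|t| * ‖dirichletSum a N t‖ * (|t| * ‖dirichletSum b L t‖)) * (n * n) := by ring
    _ ≤ 16 * (n * n) := by gcongr; exact h3.trans h5
    _ = _ := by ring

lemma norm_trig_le_dyadicAvg {n : ℕ} (hn : 1 ≤ n) {T : ℝ → ℂ} (hT : T ∈ trigSubmodule n) (x : ℝ) :
    ‖T x‖ ≤ 16 * dyadicAvg n T x := by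
  have hn0 : (1 : ℝ) ≤ n := by exact_mod_cast hn
  have h1 := norm_integral_kernel_mul_le (k := fun t => dirichletSum (-(2 * n : ℤ)) (4 * n + 1) t *
    dirichletSum (-(n : ℤ)) (2 * n + 1) t) (by fun_prop) (trig_intervalIntegrable hT) hn
    (K := 16 * n) (by positivity)
    (fun t ht => (norm_dirichletSum_mul_le _ _ (n := n) (by omega) (by omega) t).trans
      (by gcongr; norm_num))
    (fun t ht => norm_dirichletSum_mul_sq_le _ _ _ _ n ht) x
  rw [integral_reproducing hT, norm_mul] at h1
  have h2 : ‖(2 * Real.pi * (2 * n + 1) : ℂ)‖ = 2 * Real.pi * (2 * n + 1) := by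
    rw [show (2 * Real.pi * (2 * n + 1) : ℂ) = ((2 * Real.pi * (2 * n + 1) : ℝ) : ℂ) by
      push_cast; rfl,
      Complex.norm_real, Real.norm_eq_abs, abs_of_nonneg (by positivity)]
  rw [h2] at h1
  have h3 : 8 * n ≤ 2 * Real.pi * (2 * n + 1) := by nlinarith [Real.pi_gt_three]
  have h4 := (mul_le_mul_of_nonneg_right h3 (norm_nonneg (T x))).trans h1
  nlinarith

/-- The derivative kernel bounds `(n + 1) T + i T'`, and the reproducing kernel bounds the unwanted
`(n + 1) T`. This is the pointwise source of Bernstein's inequality. -/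
lemma norm_deriv_trig_le_dyadicAvg {n : ℕ} (hn : 1 ≤ n) {T : ℝ → ℂ} (hT : T ∈ trigSubmodule n)
    (x : ℝ) : ‖deriv T x‖ ≤ 64 * n * dyadicAvg n T x := by
  have hn0 : (1 : ℝ) ≤ n := by exact_mod_cast hn
  have h1 := norm_integral_kernel_mul_le (k := fun t => dirichletSum 0 (2 * n + 1) t *
    dirichletSum (-(n : ℤ)) (2 * n + 1) t) (by fun_prop) (trig_intervalIntegrable hT) hn
    (K := 16 * n) (by positivity)
    (fun t ht => (norm_dirichletSum_mul_le _ _ (n := n) (by omega) (by omega) t).trans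
      (by gcongr; norm_num))
    (fun t ht => norm_dirichletSum_mul_sq_le _ _ _ _ n ht) x
  rw [integral_derivative_kernel hT, norm_mul] at h1
  have h2 : ‖(2 * Real.pi : ℂ)‖ = 2 * Real.pi := by simp [abs_of_pos Real.pi_pos]
  rw [h2] at h1
  have h3 := norm_trig_le_dyadicAvg hn hT x
  have h4 : ‖deriv T x‖ ≤ ‖(n + 1) * T x + Complex.I * deriv T x‖ + (n + 1) * ‖T x‖ := by
    have h5 := norm_sub_le ((n + 1) * T x + Complex.I * deriv T x) ((n + 1) * T x)
    rw [add_sub_cancel_left, norm_mul, Complex.norm_I, one_mul, norm_mul (n + 1 : ℂ)] at h5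
    have h6 : ‖(n + 1 : ℂ)‖ = n + 1 := by exact_mod_cast Complex.norm_natCast (n + 1)
    rwa [h6] at h5
  have h7 : 4 * ‖(n + 1) * T x + Complex.I * deriv T x‖ ≤ 8 * (16 * n) * dyadicAvg n T x :=
    le_trans (by gcongr; linarith [Real.pi_gt_three]) h1
  have h8 : (n + 1) * ‖T x‖ ≤ (n + n) * (16 * dyadicAvg n T x) := by gcongr
  linarith

/-! ### The Jackson kernel -/

/-- The kernel is the normalized fourth power of a Dirichlet sum of length `N ≈ n / 2`. Its mass
before normalization is at least `N³ / 16`, while its size is at most `N⁴` and, after multiplication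
by `|t|⁴`, at most `π⁴`. -/
lemma exists_jackson_kernel : ∃ K : ℝ, 0 ≤ K ∧ ∀ n : ℕ, 1 ≤ n → ∃ k : ℝ → ℝ, Continuous k ∧
    (∀ t, 0 ≤ k t) ∧ ∫ t in (-Real.pi)..Real.pi, k t = 1 ∧
    (fun t => (k t : ℂ)) ∈ trigSubmodule n ∧
    ∀ t, |t| ≤ Real.pi → k t ≤ K * n ∧ k t * |n * t| ^ 4 ≤ K * n := by
  have hpi := Real.pi_pos
  refine ⟨256 * Real.pi ^ 4, by positivity, fun n hn => ?_⟩
  -- The fourth power has degree `2 (N - 1) ≤ n`, and still `N ≤ n ≤ 2 N`.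
  set N : ℕ := n / 2 + 1 with hN
  have hN1 : (1 : ℝ) ≤ N := by exact_mod_cast (by omega : 1 ≤ N)
  have hNn : (N : ℝ) ≤ n := by exact_mod_cast (by omega : N ≤ n)
  have hnN : (n : ℝ) ≤ 2 * N := by exact_mod_cast (by omega : n ≤ 2 * N)
  set W : ℝ → ℝ := fun t => ‖dirichletSum 0 N t‖ ^ 4 with hW
  have hWc : Continuous W := by fun_prop
  have hW0 : ∀ t, 0 ≤ W t := fun t => by positivity
  have hWi : ∀ a b, IntervalIntegrable W volume a b := fun a b => hWc.intervalIntegrable a b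
  set Z : ℝ := ∫ t in (-Real.pi)..Real.pi, W t with hZ
  have hZle : (N : ℝ) ^ 3 / 16 ≤ Z := by
    have hR : (1 : ℝ) / (2 * N) ≤ Real.pi := by
      rw [div_le_iff₀ (by positivity)]
      nlinarith [Real.pi_gt_three]
    have hR0 : (0 : ℝ) < 1 / (2 * N) := by positivity
    have h1 : ∫ t in (-(1 / (2 * N : ℝ)))..(1 / (2 * N)), W t ≤ Z :=
      integral_mono_interval (by linarith) (by linarith) hR
        (Filter.Eventually.of_forall hW0) (hWi _ _)
    refine le_trans ?_ h1
    have h2 := integral_mono_on (a := -(1 / (2 * N : ℝ))) (b := 1 / (2 * N)) (by linarith)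
      (intervalIntegrable_const (c := ((N : ℝ) / 2) ^ 4)) (hWi _ _)
      (fun t ht => pow_le_pow_left₀ (by positivity)
        (half_le_norm_dirichletSum (by omega) (abs_le.2 ht)) 4)
    refine le_trans (le_of_eq ?_) h2
    rw [intervalIntegral.integral_const, smul_eq_mul]
    field_simp
    norm_num
  have hZ0 : 0 < Z := lt_of_lt_of_le (by positivity) hZle
  have hZinv : Z⁻¹ ≤ 16 / (N : ℝ) ^ 3 := by
    rw [inv_le_comm₀ hZ0 (by positivity), inv_div]
    exact hZle
  refine ⟨fun t => Z⁻¹ * W t, by fun_prop, fun t => mul_nonneg (by positivity) (hW0 t), ?_, ?_, ?_⟩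
  · rw [intervalIntegral.integral_const_mul]
    exact inv_mul_cancel₀ hZ0.ne'
  · have hconj : ∀ t, (starRingEnd ℂ) (dirichletSum 0 N t) =
        ∑ i ∈ Finset.range N, trigMonomial (-i) t := by
      intro t
      rw [dirichletSum, map_sum]
      refine Finset.sum_congr rfl fun i _ => ?_
      rw [trigMonomial, trigMonomial, ← Complex.exp_conj]
      simp
    have hexp : (fun t => ((Z⁻¹ * W t : ℝ) : ℂ)) = (Z⁻¹ : ℂ) • ∑ a ∈ Finset.range N,
        ∑ b ∈ Finset.range N, ∑ c ∈ Finset.range N, ∑ d ∈ Finset.range N,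
          trigMonomial ((a : ℤ) - b + (c - d)) := by
      funext t
      have h1 : ((W t : ℝ) : ℂ) = (dirichletSum 0 N t * (starRingEnd ℂ) (dirichletSum 0 N t)) *
          (dirichletSum 0 N t * (starRingEnd ℂ) (dirichletSum 0 N t)) := by
        rw [Complex.mul_conj, ← Complex.ofReal_mul, Complex.normSq_eq_norm_sq]
        simp only [hW]
        congr 1
        ring
      have h2 : dirichletSum 0 N t * (starRingEnd ℂ) (dirichletSum 0 N t) =
          ∑ a ∈ Finset.range N, ∑ b ∈ Finset.range N, trigMonomial ((a : ℤ) - b) t := by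
        rw [hconj, dirichletSum, Finset.sum_mul_sum]
        simp only [sub_eq_add_neg, trigMonomial_add_index, zero_add]
      rw [Complex.ofReal_mul, h1, h2, Pi.smul_apply, smul_eq_mul, Complex.ofReal_inv]
      simp only [Finset.sum_apply]
      rw [Finset.sum_mul]
      congr 1
      refine Finset.sum_congr rfl fun a _ => ?_
      rw [Finset.sum_mul]
      refine Finset.sum_congr rfl fun b _ => ?_
      rw [Finset.mul_sum]
      refine Finset.sum_congr rfl fun c _ => ?_
      rw [Finset.mul_sum]
      exact Finset.sum_congr rfl fun d _ => (trigMonomial_add_index _ _ _).symm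
    rw [hexp]
    refine Submodule.smul_mem _ _ (Submodule.sum_mem _ fun a ha => Submodule.sum_mem _ fun b hb =>
      Submodule.sum_mem _ fun c hc => Submodule.sum_mem _ fun d hd => trigMonomial_mem ?_)
    simp only [Finset.mem_range] at ha hb hc hd
    rw [Finset.mem_Icc]
    omega
  · intro t ht
    have h1 : W t ≤ (N : ℝ) ^ 4 := pow_le_pow_left₀ (norm_nonneg _) (norm_dirichletSum_le 0 N t) 4
    have h2 : W t * |t| ^ 4 ≤ Real.pi ^ 4 := by
      rw [← mul_pow, mul_comm]
      exact pow_le_pow_left₀ (by positivity) (abs_mul_norm_dirichletSum_le 0 N ht) 4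
    have hpi1 : 1 ≤ Real.pi ^ 4 := one_le_pow₀ (by linarith [Real.pi_gt_three])
    constructor
    · calc Z⁻¹ * W t ≤ 16 / (N : ℝ) ^ 3 * N ^ 4 := by gcongr
        _ = 16 * N := by field_simp
        _ ≤ 256 * Real.pi ^ 4 * n := by gcongr; linarith
    · calc Z⁻¹ * W t * |n * t| ^ 4 = Z⁻¹ * (W t * |t| ^ 4) * n ^ 4 := by
            rw [abs_mul, Nat.abs_cast]; ring
        _ ≤ 16 / (N : ℝ) ^ 3 * Real.pi ^ 4 * ((2 * N) ^ 3 * n) := by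
            have : (n : ℝ) ^ 4 ≤ (2 * N) ^ 3 * n := by
              rw [pow_succ]
              gcongr
            gcongr
        _ = 128 * Real.pi ^ 4 * n := by field_simp; norm_num
        _ ≤ _ := by gcongr; norm_num

/-! ### Correlation with a polynomial kernel. -/

/-- The periodic correlation `x ↦ ∫_{-π}^{π} k(t) f(x + t) dt`. -/
def kernelMean (k f : ℝ → ℂ) : ℝ → ℂ := fun x => ∫ t in (-Real.pi)..Real.pi, k t * f (x + t)

lemma intervalIntegrable_comp_add {f : ℝ → ℂ} (hf : ∀ a b, IntervalIntegrable f volume a b)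
    (x a b : ℝ) : IntervalIntegrable (fun t => f (x + t)) volume a b := by
  simpa using (hf (x + a) (x + b)).comp_add_left x

lemma kernelMean_sub {k f g : ℝ → ℂ} (hk : Continuous k)
    (hf : ∀ a b, IntervalIntegrable f volume a b) (hg : ∀ a b, IntervalIntegrable g volume a b) :
    kernelMean k (f - g) = kernelMean k f - kernelMean k g := by
  funext x
  simp only [kernelMean, Pi.sub_apply, mul_sub]
  exact intervalIntegral.integral_sub
    ((intervalIntegrable_comp_add hf x _ _).continuousOn_mul hk.continuousOn)
    ((intervalIntegrable_comp_add hg x _ _).continuousOn_mul hk.continuousOn)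

/-- By periodicity the integral may be recentred, and a frequency `l` of the kernel contributes a
multiple of `e^{-ilx}`; the range of frequencies is symmetric. -/
lemma kernelMean_mem {k f : ℝ → ℂ} {n : ℕ} (hk : k ∈ trigSubmodule n)
    (hf : ∀ a b, IntervalIntegrable f volume a b) (hfp : Function.Periodic f (2 * Real.pi)) :
    kernelMean k f ∈ trigSubmodule n := by
  refine trig_induction (p := fun k => kernelMean k f ∈ trigSubmodule n) ?_ ?_ ?_ hk
  · have : kernelMean 0 f = 0 := by funext x; simp [kernelMean]
    rw [this]
    exact Submodule.zero_mem _
  · intro S hS T hT h1 h2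
    have : kernelMean (S + T) f = kernelMean S f + kernelMean T f := by
      funext x
      simp only [kernelMean, Pi.add_apply, add_mul]
      exact intervalIntegral.integral_add
        ((intervalIntegrable_comp_add hf x _ _).continuousOn_mul (trig_continuous hS).continuousOn)
        ((intervalIntegrable_comp_add hf x _ _).continuousOn_mul (trig_continuous hT).continuousOn)
    rw [this]
    exact Submodule.add_mem _ h1 h2
  · intro c l hl
    have : kernelMean (c • trigMonomial l) f =
        (c * ∫ t in (-Real.pi)..Real.pi, trigMonomial l t * f t) • trigMonomial (-l) := by
      funext x
      have h1 : ∀ t, (c • trigMonomial l) t * f (x + t) =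
          c * trigMonomial (-l) x * (trigMonomial l (x + t) * f (x + t)) := by
        intro t
        have h2 : trigMonomial (-l) x * trigMonomial l x = 1 := by
          rw [← trigMonomial_add_index]
          simp [trigMonomial]
        rw [trigMonomial_add, Pi.smul_apply, smul_eq_mul]
        linear_combination (-(c * trigMonomial l t * f (x + t))) * h2
      simp only [kernelMean, h1]
      rw [Pi.smul_apply, smul_eq_mul]
      rw [intervalIntegral.integral_const_mul,
        integral_comp_add_symm (fun t => trigMonomial l t * f t)]
      have h3 : Function.Periodic (fun t => trigMonomial l t * f t) (2 * Real.pi) :=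
        (trigMonomial_periodic l).mul hfp
      have h4 := h3.intervalIntegral_add_eq (x - Real.pi) (-Real.pi)
      rw [show x - Real.pi + 2 * Real.pi = x + Real.pi by ring,
        show -Real.pi + 2 * Real.pi = Real.pi by ring] at h4
      rw [h4]
      ring
    rw [this]
    refine Submodule.smul_mem _ _ (trigMonomial_mem ?_)
    rw [Finset.mem_Icc] at hl ⊢
    omega

/-- Fubini. The commutation is what makes iterating the approximation operator raise the order of
the difference. -/
lemma steklovDot_kernelMean {k f : ℝ → ℂ} (hk : Continuous k)
    (hf : ∀ a b, IntervalIntegrable f volume a b) (hfm : AEStronglyMeasurable f volume)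
    {h : ℝ} (hh : 0 < h) :
    steklovDot h (kernelMean k f) = kernelMean k (steklovDot h f) := by
  have hpi := Real.pi_pos
  funext x
  have h1 : ∀ t, k t * steklovDot h f (x + t) =
      (h : ℂ)⁻¹ * ∫ u in x..(x + h), k t * f (u + t) := by
    intro t
    rw [intervalIntegral.integral_const_mul, intervalIntegral.integral_comp_add_right,
      steklovDot_eq, show x + t + h = x + h + t by ring]
    ring
  rw [steklovDot_eq]
  simp only [kernelMean, h1, intervalIntegral.integral_const_mul]
  congr 1
  simp only [integral_of_le (show x ≤ x + h by linarith),
    integral_of_le (show -Real.pi ≤ Real.pi by linarith)]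
  have hmeas : AEStronglyMeasurable (fun p : ℝ × ℝ => k p.2 * f (p.1 + p.2))
      ((volume.restrict (Ioc x (x + h))).prod (volume.restrict (Ioc (-Real.pi) Real.pi))) := by
    rw [Measure.prod_restrict]
    refine AEStronglyMeasurable.restrict ?_
    exact (hk.comp continuous_snd).aestronglyMeasurable.mul
      (hfm.comp_quasiMeasurePreserving (quasiMeasurePreserving_add volume volume))
  refine (MeasureTheory.integral_integral_swap (μ := volume.restrict (Ioc x (x + h)))
    (ν := volume.restrict (Ioc (-Real.pi) Real.pi)) (f := fun u t => k t * f (u + t)) ?_).trans ?_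
  · rw [show Function.uncurry (fun u t => k t * f (u + t)) =
      fun p : ℝ × ℝ => k p.2 * f (p.1 + p.2) from rfl, integrable_prod_iff' hmeas]
    constructor
    · refine Filter.Eventually.of_forall fun t => ?_
      have h2 := (intervalIntegrable_comp_add hf t x (x + h)).const_mul (k t)
      rw [intervalIntegrable_iff_integrableOn_Ioc_of_le (by linarith)] at h2
      simp only [add_comm t] at h2
      exact h2
    · have h3 : ∀ t, ∫ u in Ioc x (x + h), ‖k t * f (u + t)‖ =
          ‖k t‖ * ((∫ u in (0 : ℝ)..(x + h + t), ‖f u‖) - ∫ u in (0 : ℝ)..(x + t), ‖f u‖) := by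
        intro t
        rw [← integral_of_le (by linarith)]
        simp only [norm_mul, intervalIntegral.integral_const_mul]
        rw [intervalIntegral.integral_comp_add_right (fun u => ‖f u‖),
          integral_interval_sub_left (hf _ _).norm (hf _ _).norm]
      simp only [h3]
      have hp : Continuous fun y => ∫ u in (0 : ℝ)..y, ‖f u‖ :=
        continuous_primitive (fun a b => (hf a b).norm) 0
      have hc : Continuous fun t => ‖k t‖ * ((∫ u in (0 : ℝ)..(x + h + t), ‖f u‖) -
          ∫ u in (0 : ℝ)..(x + t), ‖f u‖) :=
        hk.norm.mul ((hp.comp (continuous_const.add continuous_id)).sub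
          (hp.comp (continuous_const.add continuous_id)))
      exact (hc.intervalIntegrable (-Real.pi) Real.pi).1
  · simp only [MeasureTheory.integral_const_mul]

/-! ### Bernstein's inequality, smoothing and first-order approximation in `X`. -/

namespace PeriodicBanachLattice

variable {X : PeriodicBanachLattice}

lemma trig_mem {n : ℕ} {T : ℝ → ℂ} (hT : T ∈ trigSubmodule n) : T ∈ X.carrier := by
  refine trig_induction (p := fun T => T ∈ X.carrier) X.carrier.zero_mem
    (fun S _ T _ h1 h2 => X.carrier.add_mem h1 h2) (fun c k _ => X.carrier.smul_mem _ ?_) hT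
  exact (X.lattice _ _ (trigMonomial_periodic k) (continuous_trigMonomial k).aestronglyMeasurable
    X.one_mem (by simp [norm_trigMonomial])).1

lemma sum_half_pow_le (m : ℕ) : ∑ j ∈ Finset.range m, (1 / 2 : ℝ) ^ j ≤ 2 := by
  have h := summable_geometric_two.sum_le_tsum (Finset.range m) fun j _ => by positivity
  rwa [tsum_geometric_two] at h

lemma norm_le_of_dyadicAvg {M : ℝ} (hM : X.SteklovBound M) {g u : ℝ → ℂ} (hg : g ∈ X.carrier)
    (hup : Function.Periodic u (2 * Real.pi)) (hum : AEStronglyMeasurable u volume)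
    {n : ℕ} (hn : 1 ≤ n) {K : ℝ} (hK : 0 ≤ K) (h : ∀ x, ‖u x‖ ≤ K * dyadicAvg n g x) :
    u ∈ X.carrier ∧ X.norm u ≤ 2 * M * K * X.norm g := by
  have hn0 : (0 : ℝ) < n := by exact_mod_cast hn
  obtain ⟨h1, h2⟩ := norm_le_of_absAvg hM hg hup hum (Finset.range (n + 3))
    (fun j => K * (1 / 2) ^ j) (fun j => 2 * (2 ^ j / n)) (κ := 0)
    (fun j _ => by positivity) (fun j _ => by positivity) le_rfl (fun x => by
      rw [add_zero]
      refine (h x).trans (le_of_eq ?_)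
      rw [dyadicAvg, Finset.mul_sum]
      exact Finset.sum_congr rfl fun j _ => by ring)
  refine ⟨h1, h2.trans ?_⟩
  rw [zero_mul, add_zero, ← Finset.mul_sum]
  have h3 := X.norm_nonneg g hg
  have h4 := hM.1
  calc K * (∑ j ∈ Finset.range (n + 3), (1 / 2 : ℝ) ^ j) * M * X.norm g ≤
        K * 2 * M * X.norm g := by gcongr; exact sum_half_pow_le _
    _ = _ := by ring

/-- Bernstein's inequality. -/
lemma norm_deriv_trig_le {M : ℝ} (hM : X.SteklovBound M) {n : ℕ} (hn : 1 ≤ n) {T : ℝ → ℂ}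
    (hT : T ∈ trigSubmodule n) : X.norm (deriv T) ≤ 128 * M * n * X.norm T := by
  have hd := trig_deriv_mem hT
  have h := (norm_le_of_dyadicAvg hM (trig_mem (X := X) hT) (trig_periodic hd)
    (trig_continuous hd).aestronglyMeasurable hn (K := 64 * n) (by positivity)
    (norm_deriv_trig_le_dyadicAvg hn hT)).2
  calc _ ≤ _ := h
    _ = _ := by ring

lemma norm_add_three_le {a b c : ℝ → ℂ} (ha : a ∈ X.carrier) (hb : b ∈ X.carrier)
    (hc : c ∈ X.carrier) : X.norm (a + b + c) ≤ X.norm a + X.norm b + X.norm c :=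
  (X.norm_add_le _ (X.carrier.add_mem ha hb) _ hc).trans (by gcongr; exact X.norm_add_le _ ha _ hb)

/-- The threefold Steklov average is a smooth approximation: both the error and `h` times the
derivative are controlled by the first difference `f - Ȧ_h f`. -/
lemma smoothing_bounds {M : ℝ} (hM : X.SteklovBound M) : ∃ C, 0 ≤ C ∧ ∀ h > 0, ∀ f ∈ X.carrier,
    ∃ F ∈ X.carrier, ContDiff ℝ 1 F ∧ deriv F ∈ X.carrier ∧
      X.norm (f - F) ≤ C * X.norm (f - steklovDot h f) ∧
      X.norm (deriv F) ≤ C / h * X.norm (f - steklovDot h f) ∧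
      F = steklovDot h (steklovDot h (steklovDot h f)) := by
  obtain ⟨C₀, hC₀, hshift⟩ := norm_steklovDot_shift_sub_le hM
  have hM0 := hM.1
  refine ⟨1 + 2 * M + 2 * M * (2 * M) + C₀ * (2 * M), by positivity, fun h hh f hf => ?_⟩
  have hb : ∀ g ∈ X.carrier, steklovDot h g ∈ X.carrier ∧
      X.norm (steklovDot h g) ≤ 2 * M * X.norm g := fun g hg => steklovDot_bound hM hh hg
  have hi : ∀ g ∈ X.carrier, ∀ a b, IntervalIntegrable g volume a b := fun g hg =>
    X.intervalIntegrable hg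
  -- The first average makes the function continuous, as the shift estimate requires; the second is
  -- the average whose increments that estimate controls; differentiating the third produces these
  -- increments.
  set a := steklovDot h f with ha
  set c := steklovDot h a with hc
  set F := steklovDot h c with hF
  have haX := (hb f hf).1
  have hcX := (hb a haX).1
  have hFX := (hb c hcX).1
  have hac : Continuous a := continuous_steklovDot (hi f hf) h
  have hcc : Continuous c := continuous_steklovDot (hi a haX) h
  have hD := X.carrier.sub_mem hf haX
  have hN := X.norm_nonneg _ hD
  have e1 : a - c = steklovDot h (f - a) := (steklovDot_sub (hi f hf) (hi a haX) h).symm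
  have e2 : c - F = steklovDot h (a - c) := (steklovDot_sub (hi a haX) (hi c hcX) h).symm
  have b1 : X.norm (a - c) ≤ 2 * M * X.norm (f - a) := by rw [e1]; exact (hb _ hD).2
  have b2 : X.norm (c - F) ≤ 2 * M * (2 * M * X.norm (f - a)) := by
    rw [e2]
    exact (hb _ (X.carrier.sub_mem haX hcX)).2.trans (by gcongr)
  have hder : ∀ x, HasDerivAt F ((h : ℂ)⁻¹ * (c (x + h) - c x)) x := hasDerivAt_steklovDot hcc h
  have hdF : deriv F = (h : ℂ)⁻¹ • fun x => c (x + h) - c x := by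
    funext x
    rw [(hder x).deriv]
    rfl
  obtain ⟨s1, s2⟩ := hshift h hh a haX hac
  refine ⟨F, hFX, ?_, ?_, ?_, ?_, rfl⟩
  · rw [contDiff_one_iff_deriv]
    refine ⟨fun x => (hder x).differentiableAt, ?_⟩
    rw [hdF]
    exact (by fun_prop : Continuous fun x => c (x + h) - c x).const_smul _
  · rw [hdF]
    exact X.carrier.smul_mem _ s1
  · have e3 : f - F = (f - a) + (a - c) + (c - F) := by abel
    rw [e3]
    refine (norm_add_three_le hD (X.carrier.sub_mem haX hcX) (X.carrier.sub_mem hcX hFX)).trans ?_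
    have : 0 ≤ C₀ * (2 * M) * X.norm (f - a) := by positivity
    linarith
  · rw [hdF, X.norm_smul _ _ s1, norm_inv, Complex.norm_real, Real.norm_eq_abs, abs_of_pos hh,
      div_mul_eq_mul_div, inv_mul_eq_div]
    gcongr
    refine s2.trans ?_
    have b3 : C₀ * X.norm (a - c) ≤ C₀ * (2 * M * X.norm (f - a)) := by gcongr
    have : 0 ≤ (1 + 2 * M + 2 * M * (2 * M)) * X.norm (f - a) := by positivity
    linarith

/-- A linear approximation operator with values in `trigSubmodule n`, commuting with the Steklov
averages, with an error controlled by a first difference. -/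
lemma exists_approximation_operator {M : ℝ} (hM : X.SteklovBound M) {γ : ℝ} (hγ : 0 < γ) :
    ∃ C, 0 ≤ C ∧ ∀ n : ℕ, 1 ≤ n → ∃ V : (ℝ → ℂ) → ℝ → ℂ,
      (∀ f ∈ X.carrier, V f ∈ trigSubmodule n) ∧
      (∀ f ∈ X.carrier, ∀ g ∈ X.carrier, V (f - g) = V f - V g) ∧
      (∀ f ∈ X.carrier, steklovDot (γ / n) (V f) = V (steklovDot (γ / n) f)) ∧
      ∀ f ∈ X.carrier, X.norm (f - V f) ≤ C * X.norm (f - steklovDot (γ / n) f) := by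
  obtain ⟨K, hK, hker⟩ := exists_jackson_kernel
  obtain ⟨C₀, hC₀, hsm⟩ := smoothing_bounds hM
  have hM0 := hM.1
  refine ⟨(1 + 2 * M * (8 * K)) * C₀ + 2 * M * (64 * K) * (C₀ / γ), by positivity, fun n hn => ?_⟩
  have hn0 : (0 : ℝ) < n := by exact_mod_cast hn
  obtain ⟨k, hkc, hk0, hk1, hkT, hkb⟩ := hker n hn
  set κ : ℝ → ℂ := fun t => (k t : ℂ) with hκ
  have hκc : Continuous κ := trig_continuous hkT
  have hi : ∀ g ∈ X.carrier, ∀ a b, IntervalIntegrable g volume a b := fun g hg =>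
    X.intervalIntegrable hg
  have hmem : ∀ f ∈ X.carrier, kernelMean κ f ∈ trigSubmodule n := fun f hf =>
    kernelMean_mem hkT (hi f hf) (X.periodic f hf)
  have hκb : ∀ t, |t| ≤ Real.pi → ‖κ t‖ ≤ K * n ∧ ‖κ t‖ * |n * t| ^ 2 ≤ K * n := by
    intro t ht
    obtain ⟨h1, h2⟩ := hkb t ht
    have h3 : ‖κ t‖ = k t := by
      rw [hκ, Complex.norm_real, Real.norm_eq_abs, abs_of_nonneg (hk0 t)]
    rw [h3]
    refine ⟨h1, ?_⟩
    -- Fourth-order decay yields second-order decay: near the origin use the size bound, away from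
    -- it the larger power.
    rcases le_total |(n : ℝ) * t| 1 with h | h
    · exact (mul_le_of_le_one_right (hk0 t) (pow_le_one₀ (abs_nonneg _) h)).trans h1
    · exact (mul_le_mul_of_nonneg_left (pow_le_pow_right₀ h (by norm_num)) (hk0 t)).trans h2
  have hbound : ∀ f ∈ X.carrier, X.norm (kernelMean κ f) ≤ 2 * M * (8 * K) * X.norm f := by
    intro f hf
    exact (norm_le_of_dyadicAvg hM hf (trig_periodic (hmem f hf))
      (trig_continuous (hmem f hf)).aestronglyMeasurable hn (by positivity)
      (norm_integral_kernel_mul_le hκc (hi f hf) hn hK (fun t ht => (hκb t ht).1)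
        (fun t ht => (hκb t ht).2))).2
  refine ⟨kernelMean κ, hmem, fun f hf g hg => kernelMean_sub hκc (hi f hf) (hi g hg),
    fun f hf => steklovDot_kernelMean hκc (hi f hf) (X.measurable f hf) (by positivity),
    fun f hf => ?_⟩
  obtain ⟨F, hFX, hF1, hdF, hb1, hb2, -⟩ := hsm (γ / n) (by positivity) f hf
  have hfF := X.carrier.sub_mem hf hFX
  -- Only boundedness of the mean is used on the rough part `f - F`; the smooth part `F` gains `1/n`
  -- through its derivative, of size about `n` times the first difference.
  have e1 : f - kernelMean κ f =
      ((f - F) - kernelMean κ (f - F)) + (F - kernelMean κ F) := by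
    rw [kernelMean_sub hκc (hi f hf) (hi F hFX)]
    abel
  have hV1 : kernelMean κ (f - F) ∈ X.carrier := trig_mem (hmem _ hfF)
  have hV2 : kernelMean κ F ∈ X.carrier := trig_mem (hmem _ hFX)
  have hsub := X.carrier.sub_mem hFX hV2
  have b1 : X.norm (F - kernelMean κ F) ≤ 2 * M * (64 * K / n) * X.norm (deriv F) :=
    (norm_le_of_dyadicAvg hM hdF (X.periodic _ hsub) (X.measurable _ hsub) hn (by positivity)
      (norm_integral_kernel_mul_sub_le hkc hk0 hk1 hF1 hn hK (fun t ht => (hkb t ht).1)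
        (fun t ht => (hkb t ht).2))).2
  rw [e1]
  refine (X.norm_add_le _ (X.carrier.sub_mem hfF hV1) _ hsub).trans ?_
  have b2 := norm_sub_le hfF hV1
  have b3 := hbound _ hfF
  set d := X.norm (f - steklovDot (γ / n) f)
  have b4 : (1 + 2 * M * (8 * K)) * X.norm (f - F) ≤ (1 + 2 * M * (8 * K)) * (C₀ * d) := by gcongr
  have b5 : 2 * M * (64 * K / n) * X.norm (deriv F) ≤ 2 * M * (64 * K / n) * (C₀ / (γ / n) * d) := by
    gcongr
  have e2 : 2 * M * (64 * K / n) * (C₀ / (γ / n) * d) = 2 * M * (64 * K) * (C₀ / γ) * d := by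
    field_simp
  linarith

/-- For polynomials, the derivative is controlled by a first difference. -/
lemma norm_deriv_trig_le_steklovDot {M : ℝ} (hM : X.SteklovBound M) {γ : ℝ} (hγ : 0 < γ) :
    ∃ C, 0 ≤ C ∧ ∀ n : ℕ, 1 ≤ n → ∀ T ∈ trigSubmodule n,
      X.norm (deriv T) ≤ C * n * X.norm (T - steklovDot (γ / n) T) := by
  obtain ⟨C₀, hC₀, hsm⟩ := smoothing_bounds hM
  have hM0 := hM.1
  refine ⟨128 * M * C₀ + C₀ / γ, by positivity, fun n hn T hT => ?_⟩
  have hn0 : (0 : ℝ) < n := by exact_mod_cast hn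
  obtain ⟨F, hFX, hF1, hdF, hb1, hb2, hFeq⟩ := hsm (γ / n) (by positivity) T (trig_mem hT)
  have hFT : F ∈ trigSubmodule n := by
    rw [hFeq]
    exact trig_steklovDot_mem (trig_steklovDot_mem (trig_steklovDot_mem hT _) _) _
  have hTF := Submodule.sub_mem _ hT hFT
  -- Since `F` is again a polynomial of degree at most `n`, Bernstein applies to `T - F`.
  have e1 : deriv T = deriv (T - F) + deriv F := by
    funext x
    have : deriv (T - F) x = deriv T x - deriv F x :=
      deriv_sub (trig_differentiableAt hT x) (trig_differentiableAt hFT x)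
    simp [this]
  rw [e1]
  refine (X.norm_add_le _ (trig_mem (trig_deriv_mem hTF)) _ hdF).trans ?_
  have b1 := norm_deriv_trig_le hM hn hTF
  set d := X.norm (T - steklovDot (γ / n) T)
  have b2 : 128 * M * n * X.norm (T - F) ≤ 128 * M * n * (C₀ * d) := by gcongr
  have e2 : C₀ / (γ / n) * d = C₀ / γ * n * d := by field_simp
  linarith

end PeriodicBanachLattice

/-! ### Iterated differences -/

lemma steklovDotDiff_succ (h : ℝ) (s : ℕ) (f : ℝ → ℂ) :
    steklovDotDiff h (s + 1) f = steklovDotDiff h s f - steklovDot h (steklovDotDiff h s f) :=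
  Function.iterate_succ_apply' _ _ _

lemma steklovDotDiff_succ' (h : ℝ) (s : ℕ) (f : ℝ → ℂ) :
    steklovDotDiff h (s + 1) f = steklovDotDiff h s (f - steklovDot h f) := rfl

lemma steklovDiff_succ (h : ℝ) (r : ℕ) (f : ℝ → ℂ) :
    steklovDiff h (r + 1) f = steklovDiff h r f - steklov h (steklovDiff h r f) :=
  Function.iterate_succ_apply' _ _ _

lemma trig_steklovDotDiff_mem {n : ℕ} {T : ℝ → ℂ} (hT : T ∈ trigSubmodule n) (h : ℝ) (s : ℕ) :
    steklovDotDiff h s T ∈ trigSubmodule n := by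
  induction s with
  | zero => exact hT
  | succ s ih =>
    rw [steklovDotDiff_succ]
    exact Submodule.sub_mem _ ih (trig_steklovDot_mem ih h)

lemma trig_steklovDiff_mem {n : ℕ} {T : ℝ → ℂ} (hT : T ∈ trigSubmodule n) (h : ℝ) (r : ℕ) :
    steklovDiff h r T ∈ trigSubmodule n := by
  induction r with
  | zero => exact hT
  | succ r ih =>
    rw [steklovDiff_succ]
    exact Submodule.sub_mem _ ih (trig_steklov_mem ih h)

lemma deriv_steklovDotDiff {n : ℕ} {T : ℝ → ℂ} (hT : T ∈ trigSubmodule n) (h : ℝ) (s : ℕ) :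
    deriv (steklovDotDiff h s T) = steklovDotDiff h s (deriv T) := by
  induction s with
  | zero => rfl
  | succ s ih =>
    have h1 := trig_steklovDotDiff_mem hT h s
    rw [steklovDotDiff_succ, steklovDotDiff_succ, ← ih, steklovDot_deriv (trig_contDiff h1 1)]
    funext x
    exact deriv_sub (trig_differentiableAt h1 x)
      (trig_differentiableAt (trig_steklovDot_mem h1 h) x)

lemma deriv_steklovDiff {n : ℕ} {T : ℝ → ℂ} (hT : T ∈ trigSubmodule n) (h : ℝ) (r : ℕ) :
    deriv (steklovDiff h r T) = steklovDiff h r (deriv T) := by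
  induction r with
  | zero => rfl
  | succ r ih =>
    have h1 := trig_steklovDiff_mem hT h r
    rw [steklovDiff_succ, steklovDiff_succ, ← ih, steklov_deriv (trig_contDiff h1 1)]
    funext x
    exact deriv_sub (trig_differentiableAt h1 x)
      (trig_differentiableAt (trig_steklov_mem h1 h) x)

lemma trig_iteratedDeriv_mem {n : ℕ} {T : ℝ → ℂ} (hT : T ∈ trigSubmodule n) (s : ℕ) :
    iteratedDeriv s T ∈ trigSubmodule n := by
  induction s with
  | zero => simpa using hT
  | succ s ih =>
    rw [iteratedDeriv_succ]
    exact trig_deriv_mem ih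

/-- Over a symmetric window the linear Taylor term integrates to zero, so the error is of second
order. This is the advantage of `A_h` over the one-sided `Ȧ_h`. -/
lemma norm_sub_steklov_le {S : ℝ → ℂ} (hS : ContDiff ℝ 2 S) {h : ℝ} (hh : 0 < h) (x : ℝ) :
    ‖S x - steklov h S x‖ ≤ h ^ 2 * absAvg h (deriv (deriv S)) x := by
  have hS1 : ContDiff ℝ 1 (deriv S) := (contDiff_succ_iff_deriv.1 hS).2.2
  have hd1 : Continuous (deriv S) := hS1.continuous
  have hd2 : Continuous (deriv (deriv S)) := hS1.continuous_deriv le_rfl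
  have hSc : Continuous S := hS.continuous
  have hi : ∀ a b, IntervalIntegrable (deriv (deriv S)) volume a b := fun a b =>
    hd2.intervalIntegrable a b
  set I := h * absAvg h (deriv (deriv S)) x with hI
  have hI0 : 0 ≤ I := mul_nonneg hh.le (absAvg_nonneg hh _ _)
  have b1 : ∀ u ∈ Icc (x - h / 2) (x + h / 2), ‖deriv S u - deriv S x‖ ≤ I := by
    intro u hu
    rw [← integral_deriv_eq_sub (fun y _ => hS1.differentiable one_ne_zero y) (hi _ _)]
    refine norm_integral_le_abs_integral_norm.trans ?_
    rcases le_total x u with hxu | hxu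
    · rw [abs_of_nonneg (integral_nonneg hxu fun _ _ => norm_nonneg _)]
      exact integral_norm_le_absAvg hi hxu (by linarith) hu.2 hh
    · rw [integral_symm, abs_neg, abs_of_nonneg (integral_nonneg hxu fun _ _ => norm_nonneg _)]
      exact integral_norm_le_absAvg hi hxu hu.1 (by linarith) hh
  have b2 : ∀ t ∈ uIoc (-(h / 2)) (h / 2), ‖S (x + t) - S x - t * deriv S x‖ ≤ I * h := by
    intro t ht
    rw [uIoc_of_le (by linarith)] at ht
    have e1 : S (x + t) - S x - t * deriv S x = ∫ u in x..(x + t), (deriv S u - deriv S x) := by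
      rw [intervalIntegral.integral_sub (hd1.intervalIntegrable _ _) intervalIntegrable_const,
        integral_deriv_eq_sub (fun y _ => hS.differentiable two_ne_zero y)
          (hd1.intervalIntegrable _ _), intervalIntegral.integral_const, Complex.real_smul]
      simp
    rw [e1]
    refine (norm_integral_le_of_norm_le_const (C := I) fun u hu => b1 u ?_).trans ?_
    · have := uIoc_subset_uIcc hu
      rcases le_total 0 t with h0 | h0
      · rw [uIcc_of_le (by linarith)] at this
        exact ⟨by linarith [this.1], by linarith [this.2, ht.2]⟩
      · rw [uIcc_of_ge (by linarith)] at this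
        exact ⟨by linarith [this.1, ht.1], by linarith [this.2]⟩
    · gcongr
      rw [add_sub_cancel_left, abs_le]
      constructor <;> linarith [ht.1, ht.2]
  have hh' : (h : ℂ) ≠ 0 := by exact_mod_cast hh.ne'
  have e2 : S x - steklov h S x =
      -((h : ℂ)⁻¹ * ∫ t in (-(h / 2))..(h / 2), (S (x + t) - S x - t * deriv S x)) := by
    rw [intervalIntegral.integral_sub (Continuous.intervalIntegrable (by fun_prop) _ _)
      (Continuous.intervalIntegrable (by fun_prop) _ _),
      intervalIntegral.integral_sub (Continuous.intervalIntegrable (by fun_prop) _ _)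
      intervalIntegrable_const, integral_comp_add_symm, intervalIntegral.integral_mul_const,
      intervalIntegral.integral_const, intervalIntegral.integral_ofReal, integral_id, steklov,
      Complex.real_smul]
    have : (((h / 2) ^ 2 - (-(h / 2)) ^ 2) / 2 : ℝ) = 0 := by ring
    rw [this]
    push_cast
    field_simp
    ring
  rw [e2, norm_neg, norm_mul, norm_inv, Complex.norm_real, Real.norm_eq_abs, abs_of_pos hh,
    inv_mul_le_iff₀ hh]
  refine (norm_integral_le_of_norm_le_const b2).trans (le_of_eq ?_)
  rw [show h / 2 - -(h / 2) = h by ring, abs_of_pos hh, hI]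
  ring

/-! ### Norm estimates for iterated differences and simultaneous approximation. -/

namespace PeriodicBanachLattice

variable {X : PeriodicBanachLattice}

lemma steklovDotDiff_bound {M : ℝ} (hM : X.SteklovBound M) {h : ℝ} (hh : 0 < h) (s : ℕ)
    {f : ℝ → ℂ} (hf : f ∈ X.carrier) : steklovDotDiff h s f ∈ X.carrier ∧
      X.norm (steklovDotDiff h s f) ≤ (1 + 2 * M) ^ s * X.norm f := by
  have hM0 := hM.1
  induction s with
  | zero => exact ⟨hf, by simp [steklovDotDiff]⟩
  | succ s ih =>
    obtain ⟨h1, h2⟩ := steklovDot_bound hM hh ih.1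
    rw [steklovDotDiff_succ]
    refine ⟨X.carrier.sub_mem ih.1 h1, (norm_sub_le ih.1 h1).trans ?_⟩
    calc _ ≤ (1 + 2 * M) * X.norm (steklovDotDiff h s f) := by linarith
      _ ≤ (1 + 2 * M) * ((1 + 2 * M) ^ s * X.norm f) := by gcongr; exact ih.2
      _ = _ := by ring

lemma steklovDiff_bound {M : ℝ} (hM : X.SteklovBound M) {h : ℝ} (hh : 0 < h) (r : ℕ)
    {f : ℝ → ℂ} (hf : f ∈ X.carrier) : steklovDiff h r f ∈ X.carrier ∧
      X.norm (steklovDiff h r f) ≤ (1 + M) ^ r * X.norm f := by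
  have hM0 := hM.1
  induction r with
  | zero => exact ⟨hf, by simp [steklovDiff]⟩
  | succ r ih =>
    obtain ⟨h1, h2⟩ := hM.2 h hh _ ih.1
    rw [steklovDiff_succ]
    refine ⟨X.carrier.sub_mem ih.1 h1, (norm_sub_le ih.1 h1).trans ?_⟩
    calc _ ≤ (1 + M) * X.norm (steklovDiff h r f) := by linarith
      _ ≤ (1 + M) * ((1 + M) ^ r * X.norm f) := by gcongr; exact ih.2
      _ = _ := by ring

lemma steklovDotDiff_sub {M : ℝ} (hM : X.SteklovBound M) {h : ℝ} (hh : 0 < h) (s : ℕ)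
    {f g : ℝ → ℂ} (hf : f ∈ X.carrier) (hg : g ∈ X.carrier) :
    steklovDotDiff h s (f - g) = steklovDotDiff h s f - steklovDotDiff h s g := by
  induction s with
  | zero => rfl
  | succ s ih =>
    rw [steklovDotDiff_succ, ih, steklovDotDiff_succ, steklovDotDiff_succ,
      steklovDot_sub (X.intervalIntegrable (steklovDotDiff_bound hM hh s hf).1)
        (X.intervalIntegrable (steklovDotDiff_bound hM hh s hg).1)]
    abel

lemma steklovDiff_sub {M : ℝ} (hM : X.SteklovBound M) {h : ℝ} (hh : 0 < h) (r : ℕ)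
    {f g : ℝ → ℂ} (hf : f ∈ X.carrier) (hg : g ∈ X.carrier) :
    steklovDiff h r (f - g) = steklovDiff h r f - steklovDiff h r g := by
  induction r with
  | zero => rfl
  | succ r ih =>
    rw [steklovDiff_succ, ih, steklovDiff_succ, steklovDiff_succ,
      steklov_sub (X.intervalIntegrable (steklovDiff_bound hM hh r hf).1)
        (X.intervalIntegrable (steklovDiff_bound hM hh r hg).1)]
    abel

/-- Trade one derivative for one difference at a time; derivatives commute with the differences. -/
lemma norm_iteratedDeriv_trig_le {M : ℝ} (hM : X.SteklovBound M) {γ : ℝ} (hγ : 0 < γ) :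
    ∃ C, 0 ≤ C ∧ ∀ n : ℕ, 1 ≤ n → ∀ s : ℕ, ∀ T ∈ trigSubmodule n,
      X.norm (iteratedDeriv s T) ≤ (C * n) ^ s * X.norm (steklovDotDiff (γ / n) s T) := by
  obtain ⟨C, hC, h⟩ := norm_deriv_trig_le_steklovDot hM hγ
  refine ⟨C, hC, fun n hn s => ?_⟩
  induction s with
  | zero => intro T _; simp [steklovDotDiff]
  | succ s ih =>
    intro T hT
    rw [iteratedDeriv_succ']
    refine (ih _ (trig_deriv_mem hT)).trans ?_
    rw [← deriv_steklovDotDiff hT, pow_succ, mul_assoc, steklovDotDiff_succ]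
    gcongr
    exact h n hn _ (trig_steklovDotDiff_mem hT _ _)

/-- Simultaneous approximation by trigonometric polynomials. -/
lemma exists_trig_approximation {M : ℝ} (hM : X.SteklovBound M) {γ : ℝ} (hγ : 0 < γ) (s : ℕ) :
    ∃ C, 0 ≤ C ∧ ∀ n : ℕ, 1 ≤ n → ∀ f ∈ X.carrier, ∃ T ∈ trigSubmodule n,
      X.norm (f - T) ≤ C * X.norm (steklovDotDiff (γ / n) s f) ∧
      ((n : ℝ) ^ s)⁻¹ * X.norm (iteratedDeriv s T) ≤
        C * X.norm (steklovDotDiff (γ / n) s f) := by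
  obtain ⟨C₁, hC₁, hV⟩ := exists_approximation_operator hM hγ
  obtain ⟨C₂, hC₂, hder⟩ := norm_iteratedDeriv_trig_le hM hγ
  have hM0 := hM.1
  refine ⟨C₁ ^ s + C₂ ^ s * (1 + (1 + 2 * M) ^ s * C₁ ^ s), by positivity, fun n hn f hf => ?_⟩
  have hn0 : (0 : ℝ) < n := by exact_mod_cast hn
  have hh : 0 < γ / n := by positivity
  obtain ⟨V, hVT, hVsub, hVcomm, hVb⟩ := hV n hn
  set h := γ / (n : ℝ)
  -- The approximant is `f - L^s f`. Each power of `L` costs one difference, and since `L` commutes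
  -- with `I - Ȧ_h` these accumulate to order `s`.
  set L : (ℝ → ℂ) → ℝ → ℂ := fun g => g - V g with hL
  have hLX : ∀ g ∈ X.carrier, L g ∈ X.carrier := fun g hg =>
    X.carrier.sub_mem hg (trig_mem (hVT g hg))
  have hLiX : ∀ j : ℕ, ∀ g ∈ X.carrier, L^[j] g ∈ X.carrier := by
    intro j
    induction j with
    | zero => exact fun g hg => hg
    | succ j ih => exact fun g hg => ih _ (hLX g hg)
  have hSX : ∀ g ∈ X.carrier, steklovDot h g ∈ X.carrier := fun g hg =>
    (steklovDot_bound hM hh hg).1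
  have hcomm : ∀ g ∈ X.carrier, L g - steklovDot h (L g) = L (g - steklovDot h g) := by
    intro g hg
    simp only [hL]
    rw [steklovDot_sub (X.intervalIntegrable hg) (X.intervalIntegrable (trig_mem (hVT g hg))),
      hVsub g hg _ (hSX g hg), hVcomm g hg]
    abel
  have hcommi : ∀ j : ℕ, ∀ g ∈ X.carrier,
      L^[j] g - steklovDot h (L^[j] g) = L^[j] (g - steklovDot h g) := by
    intro j
    induction j with
    | zero => exact fun g _ => rfl
    | succ j ih =>
      intro g hg
      rw [Function.iterate_succ_apply, Function.iterate_succ_apply, ih _ (hLX g hg), hcomm g hg]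
  have hLb : ∀ j : ℕ, ∀ g ∈ X.carrier,
      X.norm (L^[j] g) ≤ C₁ ^ j * X.norm (steklovDotDiff h j g) := by
    intro j
    induction j with
    | zero => intro g _; simp [steklovDotDiff]
    | succ j ih =>
      intro g hg
      rw [Function.iterate_succ_apply', pow_succ', mul_assoc, steklovDotDiff_succ']
      refine (hVb _ (hLiX j g hg)).trans ?_
      rw [hcommi j g hg]
      gcongr
      exact ih _ (X.carrier.sub_mem hg (hSX g hg))
  have hTmem : ∀ j : ℕ, f - L^[j] f ∈ trigSubmodule n := by
    intro j
    induction j with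
    | zero => simp
    | succ j ih =>
      rw [Function.iterate_succ_apply']
      have : f - L (L^[j] f) = (f - L^[j] f) + V (L^[j] f) := by
        simp only [hL]
        abel
      rw [this]
      exact Submodule.add_mem _ ih (hVT _ (hLiX j f hf))
  have hT := hTmem s
  set d := X.norm (steklovDotDiff h s f) with hd
  have hd0 : 0 ≤ d := X.norm_nonneg _ (steklovDotDiff_bound hM hh s hf).1
  have b1 : X.norm (L^[s] f) ≤ C₁ ^ s * d := hLb s f hf
  refine ⟨f - L^[s] f, hT, ?_, ?_⟩
  · rw [sub_sub_cancel]
    refine b1.trans ?_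
    gcongr
    exact le_add_of_nonneg_right (by positivity)
  · rw [inv_mul_le_iff₀ (by positivity)]
    refine (hder n hn s _ hT).trans ?_
    -- On the remainder `L^s f` the differences are merely bounded, because it is already as small
    -- as required.
    have b2 : X.norm (steklovDotDiff h s (f - L^[s] f)) ≤
        d + (1 + 2 * M) ^ s * (C₁ ^ s * d) := by
      have hLs := hLiX s f hf
      rw [steklovDotDiff_sub hM hh s hf hLs]
      refine (norm_sub_le (steklovDotDiff_bound hM hh s hf).1
        (steklovDotDiff_bound hM hh s hLs).1).trans ?_
      gcongr
      exact (steklovDotDiff_bound hM hh s hLs).2.trans (by gcongr)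
    calc _ ≤ (C₂ * n) ^ s * (d + (1 + 2 * M) ^ s * (C₁ ^ s * d)) := by gcongr
      _ = (n : ℝ) ^ s * ((C₂ ^ s * (1 + (1 + 2 * M) ^ s * C₁ ^ s)) * d) := by rw [mul_pow]; ring
      _ ≤ _ := by
        gcongr
        exact le_add_of_nonneg_left (by positivity)

lemma norm_iteratedDeriv_add_le {M : ℝ} (hM : X.SteklovBound M) {n : ℕ} (hn : 1 ≤ n) {T : ℝ → ℂ}
    (hT : T ∈ trigSubmodule n) (j i : ℕ) :
    X.norm (iteratedDeriv (j + i) T) ≤ (128 * M * n) ^ i * X.norm (iteratedDeriv j T) := by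
  have hM0 := hM.1
  induction i with
  | zero => simp
  | succ i ih =>
    rw [← add_assoc, iteratedDeriv_succ, pow_succ', mul_assoc]
    exact (norm_deriv_trig_le hM hn (trig_iteratedDeriv_mem hT _)).trans (by gcongr)

lemma norm_steklovDiff_trig_le {M : ℝ} (hM : X.SteklovBound M) {h : ℝ} (hh : 0 < h) {n : ℕ}
    (r : ℕ) : ∀ T ∈ trigSubmodule n,
      X.norm (steklovDiff h r T) ≤ (M * h ^ 2) ^ r * X.norm (iteratedDeriv (2 * r) T) := by
  have hM0 := hM.1
  induction r with
  | zero => intro T _; simp [steklovDiff]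
  | succ r ih =>
    intro T hT
    have hD := trig_steklovDiff_mem hT h r
    have hD' := trig_steklovDiff_mem hT h (r + 1)
    have h2 : deriv (deriv (steklovDiff h r T)) = steklovDiff h r (deriv (deriv T)) := by
      rw [deriv_steklovDiff hT, deriv_steklovDiff (trig_deriv_mem hT)]
    have h1 := (norm_le_of_absAvg hM (trig_mem (X := X) (trig_deriv_mem (trig_deriv_mem hD)))
      (trig_periodic hD') (trig_continuous hD').aestronglyMeasurable (Finset.univ : Finset Unit)
      (fun _ => h ^ 2) (fun _ => h) (κ := 0) (fun _ _ => by positivity) (fun _ _ => hh) le_rfl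
      (fun x => by
        rw [steklovDiff_succ]
        simpa using norm_sub_steklov_le (trig_contDiff hD 2) hh x)).2
    simp only [Finset.univ_unique, Finset.sum_const, Finset.card_singleton, one_smul, zero_mul,
      add_zero, h2] at h1
    refine h1.trans ?_
    have h3 := ih _ (trig_deriv_mem (trig_deriv_mem hT))
    rw [← iteratedDeriv_succ', ← iteratedDeriv_succ'] at h3
    rw [show 2 * (r + 1) = 2 * r + 1 + 1 by ring, pow_succ' (M * h ^ 2), mul_assoc (M * h ^ 2),
      mul_comm M (h ^ 2)]
    rw [mul_comm M (h ^ 2)] at h3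
    gcongr

end PeriodicBanachLattice

/-! ### Discrete seminorms -/

lemma periodicIndicator_apply (E : Set ℝ) (t : ℝ) [Decidable (∃ j : ℤ, t + 2 * Real.pi * j ∈ E)] :
    periodicIndicator E t = if ∃ j : ℤ, t + 2 * Real.pi * j ∈ E then 1 else 0 := by
  simp only [periodicIndicator, indicator, mem_ofPred_eq]

lemma periodicIndicator_periodic (E : Set ℝ) :
    Function.Periodic (periodicIndicator E) (2 * Real.pi) := by
  classical
  intro t
  rw [periodicIndicator_apply, periodicIndicator_apply]
  refine if_congr ⟨?_, ?_⟩ rfl rfl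
  · rintro ⟨j, hj⟩
    refine ⟨j + 1, ?_⟩
    convert hj using 1
    push_cast
    ring
  · rintro ⟨j, hj⟩
    refine ⟨j - 1, ?_⟩
    convert hj using 1
    push_cast
    ring

lemma measurable_periodicIndicator {E : Set ℝ} (hE : MeasurableSet E) :
    Measurable (periodicIndicator E) := by
  refine measurable_const.indicator ?_
  rw [ofPred_exists]
  exact MeasurableSet.iUnion fun j => (measurable_id.add_const _) hE

lemma norm_periodicIndicator_le (E : Set ℝ) (t : ℝ) : ‖periodicIndicator E t‖ ≤ 1 := by
  classical
  rw [periodicIndicator_apply]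
  split_ifs <;> simp

namespace PeriodicBanachLattice

variable {X : PeriodicBanachLattice}

lemma periodicIndicator_mem {E : Set ℝ} (hE : MeasurableSet E) :
    periodicIndicator E ∈ X.carrier :=
  (X.lattice _ _ (periodicIndicator_periodic E) (measurable_periodicIndicator hE).aestronglyMeasurable
    X.one_mem (by simpa using Filter.Eventually.of_forall (norm_periodicIndicator_le E))).1

end PeriodicBanachLattice

namespace SamplingScheme

open PeriodicBanachLattice

variable {X : PeriodicBanachLattice} {γ δ : ℝ} (G : SamplingScheme X γ δ)

/-- The step function whose norm is the discrete seminorm. -/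
def stepFun (n : ℕ) (f : ℝ → ℂ) (t : ℝ) : ℂ :=
  ∑ k ∈ Finset.Icc 1 (G.m n),
    ((‖f (G.node n k)‖ : ℝ) : ℂ) *
      periodicIndicator (Set.Ico (G.node n k) (G.node n (k + 1))) t

lemma discNorm_eq (n : ℕ) (f : ℝ → ℂ) : G.discNorm n f = X.norm (G.stepFun n f) := rfl

lemma stepFun_eq_sum (n : ℕ) (f : ℝ → ℂ) : G.stepFun n f = ∑ k ∈ Finset.Icc 1 (G.m n),
    ((‖f (G.node n k)‖ : ℝ) : ℂ) •
      periodicIndicator (Set.Ico (G.node n k) (G.node n (k + 1))) := by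
  funext t
  simp [stepFun]

lemma stepFun_mem (n : ℕ) (f : ℝ → ℂ) : G.stepFun n f ∈ X.carrier := by
  rw [stepFun_eq_sum]
  exact X.carrier.sum_mem fun k _ =>
    X.carrier.smul_mem _ (periodicIndicator_mem measurableSet_Ico)

lemma discNorm_nonneg (n : ℕ) (f : ℝ → ℂ) : 0 ≤ G.discNorm n f :=
  X.norm_nonneg _ (G.stepFun_mem n f)

/-- At a fixed point the step function is a nonnegative combination of the sampled absolute values,
with weights independent of `f`; the triangle inequality for the discrete seminorm follows. -/
lemma exists_stepFun_eq_ofReal (n : ℕ) (t : ℝ) : ∃ c : ℕ → ℝ, (∀ k, 0 ≤ c k) ∧ ∀ f : ℝ → ℂ,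
    G.stepFun n f t = ((∑ k ∈ Finset.Icc 1 (G.m n), ‖f (G.node n k)‖ * c k : ℝ) : ℂ) := by
  classical
  refine ⟨fun k => if ∃ j : ℤ, t + 2 * Real.pi * j ∈ Set.Ico (G.node n k) (G.node n (k + 1))
    then 1 else 0, fun k => by dsimp only; split_ifs <;> norm_num, fun f => ?_⟩
  rw [stepFun, Complex.ofReal_sum]
  refine Finset.sum_congr rfl fun k _ => ?_
  rw [periodicIndicator_apply]
  dsimp only
  by_cases hj : ∃ j : ℤ, t + 2 * Real.pi * j ∈ Set.Ico (G.node n k) (G.node n (k + 1))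
  · rw [if_pos hj, if_pos hj, mul_one, mul_one]
  · rw [if_neg hj, if_neg hj, mul_zero, mul_zero, Complex.ofReal_zero]

lemma discNorm_add_le (n : ℕ) (f g : ℝ → ℂ) :
    G.discNorm n (f + g) ≤ G.discNorm n f + G.discNorm n g := by
  have hf := G.stepFun_mem n f
  have hg := G.stepFun_mem n g
  have h := X.lattice _ _ (X.periodic _ (G.stepFun_mem n (f + g)))
    (X.measurable _ (G.stepFun_mem n (f + g))) (X.carrier.add_mem hf hg)
    (Filter.Eventually.of_forall fun t => by
      obtain ⟨c, hc, h⟩ := G.exists_stepFun_eq_ofReal n t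
      rw [Pi.add_apply, h, h, h, ← Complex.ofReal_add, Complex.norm_real, Complex.norm_real,
        Real.norm_eq_abs, Real.norm_eq_abs, ← Finset.sum_add_distrib]
      refine abs_le_abs_of_nonneg
        (Finset.sum_nonneg fun k _ => mul_nonneg (norm_nonneg _) (hc k))
        (Finset.sum_le_sum fun k _ => ?_)
      rw [← add_mul]
      exact mul_le_mul_of_nonneg_right (norm_add_le _ _) (hc k))
  exact h.2.trans (X.norm_add_le _ hf _ hg)

lemma discNorm_sub_le (n : ℕ) (f g : ℝ → ℂ) :
    G.discNorm n (f - g) ≤ G.discNorm n f + G.discNorm n g := by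
  have h : G.discNorm n (-g) = G.discNorm n g := by simp [discNorm]
  rw [sub_eq_add_neg, ← h]
  exact G.discNorm_add_le n f (-g)

variable {G}

lemma node_le_node (hγ : 0 < γ) {n : ℕ} (hn : 1 ≤ n) {k l : ℕ} (hk : 1 ≤ k) (hkl : k ≤ l)
    (hl : l ≤ G.m n + 1) : G.node n k ≤ G.node n l := by
  induction l, hkl using Nat.le_induction with
  | base => exact le_rfl
  | succ l hkl ih =>
    have h1 := G.gap_lower n hn l (Finset.mem_Icc.2 ⟨by omega, by omega⟩)
    have h2 : 0 < γ / n := div_pos hγ (by exact_mod_cast hn)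
    linarith [ih (by omega)]

/-- All cells lie in one period, from the first node to its translate by `2π`, and there they are
ordered. Two translates of one point in different cells would need an integer strictly between `i`
and `i + 1`. -/
lemma not_mem_of_lt (hγ : 0 < γ) {n : ℕ} (hn : 1 ≤ n) {k l : ℕ} (hk : 1 ≤ k) (hkl : k < l)
    (hl : l ≤ G.m n) {t : ℝ} {i j : ℤ}
    (h1 : t + 2 * Real.pi * i ∈ Set.Ico (G.node n k) (G.node n (k + 1)))
    (h2 : t + 2 * Real.pi * j ∈ Set.Ico (G.node n l) (G.node n (l + 1))) : False := by
  have a1 := node_le_node (G := G) hγ hn le_rfl hk (by omega)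
  have a2 := node_le_node (G := G) hγ hn (k := k + 1) (l := l) (by omega) hkl (by omega)
  have a3 := node_le_node (G := G) hγ hn (k := l + 1) (l := G.m n + 1) (by omega) (by omega) le_rfl
  have a4 := G.node_wrap n hn
  have hpi := Real.pi_pos
  have b1 : (i : ℝ) < j := by nlinarith [h1.1, h1.2, h2.1, h2.2]
  have b2 : (j : ℝ) < i + 1 := by nlinarith [h1.1, h1.2, h2.1, h2.2]
  have c1 : i < j := by exact_mod_cast b1
  have c2 : j < i + 1 := by exact_mod_cast b2
  omega

/-- Cells are disjoint on the circle, so at most one summand is nonzero at each point. -/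
lemma norm_stepFun_le (hγ : 0 < γ) {n : ℕ} (hn : 1 ≤ n) {f : ℝ → ℂ} {Φ : ℝ → ℝ}
    (hΦp : Function.Periodic Φ (2 * Real.pi)) (hΦ0 : ∀ x, 0 ≤ Φ x)
    (h : ∀ k ∈ Finset.Icc 1 (G.m n), ∀ x ∈ Set.Ico (G.node n k) (G.node n (k + 1)),
      ‖f (G.node n k)‖ ≤ Φ x) (t : ℝ) : ‖G.stepFun n f t‖ ≤ Φ t := by
  classical
  by_cases hex : ∃ k ∈ Finset.Icc 1 (G.m n), ∃ j : ℤ,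
      t + 2 * Real.pi * j ∈ Set.Ico (G.node n k) (G.node n (k + 1))
  · obtain ⟨k, hk, j, hj⟩ := hex
    rw [stepFun, Finset.sum_eq_single_of_mem k hk]
    · rw [periodicIndicator_apply, if_pos ⟨j, hj⟩, mul_one, Complex.norm_real, norm_norm]
      refine (h k hk _ hj).trans (le_of_eq ?_)
      have := hΦp.int_mul j t
      rwa [mul_comm (j : ℝ)] at this
    · intro l hl hlk
      rw [periodicIndicator_apply, if_neg, mul_zero]
      rintro ⟨i, hi⟩
      rw [Finset.mem_Icc] at hl hk
      rcases lt_or_gt_of_ne hlk with hlt | hlt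
      · exact not_mem_of_lt hγ hn hl.1 hlt hk.2 hi hj
      · exact not_mem_of_lt hγ hn hk.1 hlt hl.2 hj hi
  · push Not at hex
    rw [stepFun, Finset.sum_eq_zero]
    · simpa using hΦ0 t
    · intro k hk
      rw [periodicIndicator_apply, if_neg, mul_zero]
      rintro ⟨j, hj⟩
      exact hex k hk j hj

/-- A node is within `δ / n` of every point of its cell, so enlarged windows centred at the point
dominate the sample. The hypothesis on `K` keeps the enlargement proportional, and so suits windows
no shorter than order `1/n`. -/
lemma discNorm_le_of_absAvg (hγ : 0 < γ) (hδ : 0 < δ) {M : ℝ} (hM : X.SteklovBound M) {n : ℕ} (hn : 1 ≤ n)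
    {g u : ℝ → ℂ} (hg : g ∈ X.carrier) {ι : Type*} (s : Finset ι) (w H : ι → ℝ) {K : ℝ}
    (hw : ∀ i ∈ s, 0 ≤ w i) (hH : ∀ i ∈ s, 0 < H i)
    (hK : ∀ i ∈ s, (H i + 2 * (δ / n)) / H i ≤ K)
    (h : ∀ x, ‖u x‖ ≤ ∑ i ∈ s, w i * absAvg (H i) g x) :
    G.discNorm n u ≤ (∑ i ∈ s, w i) * K * M * X.norm g := by
  have hi := X.intervalIntegrable hg
  have hstep := G.stepFun_mem n u
  have hδ' : 0 ≤ δ / n := div_nonneg hδ.le n.cast_nonneg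
  have hH' : ∀ i ∈ s, 0 < H i + 2 * (δ / n) := fun i hi => by linarith [hH i hi]
  have hK' : ∀ i ∈ s, 0 ≤ K := fun i hi =>
    (div_nonneg (hH' i hi).le (hH i hi).le).trans (hK i hi)
  have hA : ∀ i ∈ s, ∀ x, 0 ≤ absAvg (H i + 2 * (δ / n)) g x := fun i hi x =>
    absAvg_nonneg (hH' i hi) g x
  have hb : ∀ t, ‖G.stepFun n u t‖ ≤ ∑ i ∈ s, w i * K * absAvg (H i + 2 * (δ / n)) g t := by
    refine norm_stepFun_le hγ hn ?_ ?_ ?_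
    · intro x
      exact Finset.sum_congr rfl fun i _ => by rw [absAvg_periodic (X.periodic g hg)]
    · exact fun x => Finset.sum_nonneg fun i hi =>
        mul_nonneg (mul_nonneg (hw i hi) (hK' i hi)) (hA i hi x)
    · intro k hk x hx
      refine (h _).trans (Finset.sum_le_sum fun i his => ?_)
      have hgap := G.gap_upper n hn k hk
      have hd : |x - G.node n k| ≤ δ / n := by
        rw [abs_of_nonneg (by linarith [hx.1])]
        linarith [hx.2]
      rw [mul_assoc]
      refine mul_le_mul_of_nonneg_left ?_ (hw i his)
      exact (absAvg_le_absAvg hi (hH i his) hd).trans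
        (mul_le_mul_of_nonneg_right (hK i his) (hA i his x))
  have h1 := (norm_le_of_absAvg hM hg (X.periodic _ hstep) (X.measurable _ hstep) s
    (fun i => w i * K) (fun i => H i + 2 * (δ / n)) (κ := 0)
    (fun i hi => mul_nonneg (hw i hi) (hK' i hi)) hH' le_rfl (by simpa using hb)).2
  rw [← Finset.sum_mul, zero_mul, add_zero] at h1
  exact h1

end SamplingScheme

/-! ### Sampling of Steklov averages and of polynomials. -/

namespace SamplingScheme

open PeriodicBanachLattice

variable {X : PeriodicBanachLattice} {γ δ : ℝ} {G : SamplingScheme X γ δ}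

lemma op_mem {n : ℕ} (hn : 1 ≤ n) (f : ℝ → ℂ) : G.op n f ∈ X.carrier := by
  have : G.op n f = ∑ k ∈ Finset.Icc 1 (G.m n), f (G.node n k) • G.phi n k := by
    funext x
    simp [op]
  rw [this]
  exact X.carrier.sum_mem fun k hk => X.carrier.smul_mem _ (G.phi_mem n hn k hk)

lemma op_sub (n : ℕ) (f g : ℝ → ℂ) : G.op n (f - g) = G.op n f - G.op n g := by
  funext x
  simp [op, sub_mul]

lemma discNorm_steklov_le (hγ : 0 < γ) (hδ : 0 < δ) {M : ℝ} (hM : X.SteklovBound M) {n : ℕ}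
    (hn : 1 ≤ n) {u : ℝ → ℂ} (hu : u ∈ X.carrier) :
    G.discNorm n (steklov (γ / n) u) ≤ ((γ + 2 * δ) / γ) * M * X.norm u := by
  have hn0 : (0 : ℝ) < n := by exact_mod_cast hn
  have hh : 0 < γ / n := by positivity
  have h := discNorm_le_of_absAvg (G := G) hγ hδ hM hn hu (u := steklov (γ / n) u)
    (Finset.univ : Finset Unit) (fun _ => 1) (fun _ => γ / n) (K := (γ + 2 * δ) / γ)
    (fun _ _ => zero_le_one) (fun _ _ => hh) (fun _ _ => le_of_eq (by field_simp)) (fun x => by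
      simp only [Finset.univ_unique, Finset.sum_const, Finset.card_singleton, one_smul, one_mul]
      rw [steklov, absAvg, norm_mul, norm_inv, Complex.norm_real, Real.norm_eq_abs, abs_of_pos hh]
      gcongr
      exact intervalIntegral.norm_integral_le_integral_norm (by linarith))
  simpa using h

/-- Telescoping writes the function as the sum of `A_h (I - A_h)^i u` over `i < r`. Every summand is
a Steklov average, so its samples are controlled by the norm of `X` although those of `u` are not.
-/
lemma discNorm_sub_steklovDiff_le (hγ : 0 < γ) (hδ : 0 < δ) {M : ℝ} (hM : X.SteklovBound M)
    {n : ℕ} (hn : 1 ≤ n) {u : ℝ → ℂ} (hu : u ∈ X.carrier) (r : ℕ) :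
    G.discNorm n (u - steklovDiff (γ / n) r u) ≤
      (∑ i ∈ Finset.range r, (γ + 2 * δ) / γ * M * (1 + M) ^ i) * X.norm u := by
  have hn0 : (0 : ℝ) < n := by exact_mod_cast hn
  have hh : 0 < γ / n := by positivity
  have hM0 := hM.1
  induction r with
  | zero =>
    have h0 : u - steklovDiff (γ / n) 0 u = 0 := sub_self u
    have h1 : G.discNorm n 0 = 0 := by
      rw [discNorm_eq, stepFun_eq_sum]
      simp [PeriodicBanachLattice.norm_zero]
    rw [h0, h1]
    simp
  | succ r ih =>
    obtain ⟨h1, h2⟩ := steklovDiff_bound hM hh r hu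
    have e : u - steklovDiff (γ / n) (r + 1) u =
        (u - steklovDiff (γ / n) r u) + steklov (γ / n) (steklovDiff (γ / n) r u) := by
      rw [steklovDiff_succ]
      abel
    rw [e, Finset.sum_range_succ, add_mul]
    refine (G.discNorm_add_le _ _ _).trans (add_le_add ih ?_)
    refine (discNorm_steklov_le hγ hδ hM hn h1).trans ?_
    rw [mul_assoc ((γ + 2 * δ) / γ * M)]
    gcongr

/-- A Marcinkiewicz type inequality: the reproducing kernel bounds polynomials pointwise by averages
at scales at least `1/n`, and these survive the move from node to cell with the factor `1 + δ`. -/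
lemma discNorm_trig_le (hγ : 0 < γ) (hδ : 0 < δ) {M : ℝ} (hM : X.SteklovBound M) {n : ℕ}
    (hn : 1 ≤ n) {S : ℝ → ℂ} (hS : S ∈ trigSubmodule n) :
    G.discNorm n S ≤ 32 * (1 + δ) * M * X.norm S := by
  have hn0 : (0 : ℝ) < n := by exact_mod_cast hn
  have hSX : S ∈ X.carrier := trig_mem hS
  have h := discNorm_le_of_absAvg (G := G) hγ hδ hM hn hSX (u := S)
    (Finset.range (n + 3)) (fun j => 16 * (1 / 2) ^ j) (fun j => 2 * (2 ^ j / n)) (K := 1 + δ)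
    (fun _ _ => by positivity) (fun _ _ => by positivity) (fun j _ => by
      rw [div_le_iff₀ (by positivity)]
      have h1 : (1 : ℝ) ≤ 2 ^ j := one_le_pow₀ (by norm_num)
      have h2 : δ / n ≤ δ * (2 ^ j / n) := by
        rw [div_eq_mul_one_div]
        gcongr
      linarith) (fun x => by
      refine (norm_trig_le_dyadicAvg hn hS x).trans (le_of_eq ?_)
      rw [dyadicAvg, Finset.mul_sum]
      exact Finset.sum_congr rfl fun j _ => by ring)
  refine h.trans ?_
  rw [← Finset.mul_sum]
  have hM0 := hM.1
  have hN := X.norm_nonneg S hSX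
  have h3 := sum_half_pow_le (n + 3)
  calc 16 * (∑ j ∈ Finset.range (n + 3), (1 / 2 : ℝ) ^ j) * (1 + δ) * M * X.norm S ≤
      16 * 2 * (1 + δ) * M * X.norm S := by gcongr
    _ = _ := by ring

/-- The second-order gain produces `n^{-2r}` and `2r` derivatives; the `2r - s` surplus derivatives
are removed by Bernstein at the price `n^{2r - s}`. -/
lemma discNorm_steklovDiff_trig_le (hγ : 0 < γ) (hδ : 0 < δ) {M : ℝ} (hM : X.SteklovBound M)
    {n : ℕ} (hn : 1 ≤ n) {T : ℝ → ℂ} (hT : T ∈ trigSubmodule n) {r s : ℕ} (hrs : s ≤ 2 * r) :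
    G.discNorm n (steklovDiff (γ / n) r T) ≤
      32 * (1 + δ) * M * ((M * γ ^ 2) ^ r * (128 * M) ^ (2 * r - s)) *
        (((n : ℝ) ^ s)⁻¹ * X.norm (iteratedDeriv s T)) := by
  have hn0 : (0 : ℝ) < n := by exact_mod_cast hn
  have hh : 0 < γ / n := by positivity
  have hM0 := hM.1
  refine (discNorm_trig_le hγ hδ hM hn (trig_steklovDiff_mem hT _ r)).trans ?_
  rw [mul_assoc (32 * (1 + δ) * M)]
  gcongr
  refine (norm_steklovDiff_trig_le hM hh r T hT).trans ?_
  have h1 := norm_iteratedDeriv_add_le hM hn hT s (2 * r - s)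
  rw [show s + (2 * r - s) = 2 * r by omega] at h1
  have h2 : ((n : ℝ) ^ 2) ^ r = (n : ℝ) ^ (2 * r - s) * n ^ s := by
    rw [← pow_mul, ← pow_add]
    congr 1
    omega
  calc (M * (γ / n) ^ 2) ^ r * X.norm (iteratedDeriv (2 * r) T) ≤
        (M * (γ / n) ^ 2) ^ r * ((128 * M * n) ^ (2 * r - s) * X.norm (iteratedDeriv s T)) := by
        gcongr
    _ = _ := by
        rw [div_pow, ← mul_div_assoc, div_pow, h2, mul_pow (128 * M)]
        field_simp

end SamplingScheme

end

/-! ### Assembly of the two estimates. -/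

theorem theorem3p1 (X : PeriodicBanachLattice) (hA : X.SteklovBounded)
    (r s : ℕ) (hr : 1 ≤ r) (hs : 1 ≤ s) (hrs : s ≤ 2 * r)
    (γ δ : ℝ) (hγ : 0 < γ) (hδ : 0 < δ)
    (K₁ K₃ : ℝ) (hK₁ : 0 < K₁) (hK₃ : 0 < K₃) :
    ∃ C > 0, ∀ G : SamplingScheme X γ δ, G.Stable K₁ → G.PolyJackson s K₃ →
      (∀ n : ℕ, 1 ≤ n → ∀ f ∈ X.carrier,
        X.norm (f - G.op n f) ≤
          C * (X.norm (steklovDotDiff (γ / n) s f) + G.discNorm n (steklovDiff (γ / n) r f))) ∧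
      ((∀ n : ℕ, 1 ≤ n → ∀ f ∈ X.carrier, G.op n f ∈ trigPoly n) →
        ∀ n : ℕ, 1 ≤ n → ∀ f ∈ X.carrier,
          G.discNorm n (f - G.op n f) ≤
            C * (X.norm (steklovDotDiff (γ / n) s f) +
              G.discNorm n (steklovDiff (γ / n) r f))) := by
  obtain ⟨M, hM⟩ := PeriodicBanachLattice.SteklovBounded.exists_bound hA
  have hM0 := hM.1
  obtain ⟨C, hC, happ⟩ := PeriodicBanachLattice.exists_trig_approximation hM hγ s
  set A := ∑ i ∈ Finset.range r, (γ + 2 * δ) / γ * M * (1 + M) ^ i with hAdef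
  have hA0 : 0 ≤ A := Finset.sum_nonneg fun i _ => by positivity
  set B := 32 * (1 + δ) * M * ((M * γ ^ 2) ^ r * (128 * M) ^ (2 * r - s)) with hB
  have hB0 : 0 ≤ B := by positivity
  set P := 32 * (1 + δ) * M with hP
  have hP0 : 0 ≤ P := by positivity
  set D := 1 + B * C + A * C with hD
  have hD0 : 0 ≤ D := by positivity
  set E := C + K₃ * C + K₁ * D with hE
  have hE0 : 0 ≤ E := by positivity
  have key : ∀ G : SamplingScheme X γ δ, G.Stable K₁ → G.PolyJackson s K₃ →
      ∀ n : ℕ, 1 ≤ n → ∀ f ∈ X.carrier, ∃ T ∈ trigSubmodule n,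
        X.norm (f - T) ≤ C * (X.norm (steklovDotDiff (γ / n) s f) +
          G.discNorm n (steklovDiff (γ / n) r f)) ∧
        G.discNorm n (f - T) ≤ D * (X.norm (steklovDotDiff (γ / n) s f) +
          G.discNorm n (steklovDiff (γ / n) r f)) ∧
        X.norm (f - G.op n f) ≤ E * (X.norm (steklovDotDiff (γ / n) s f) +
          G.discNorm n (steklovDiff (γ / n) r f)) := by
    intro G hstab hjack n hn f hf
    have hn0 : (0 : ℝ) < n := by exact_mod_cast hn
    have hh : 0 < γ / n := by positivity
    obtain ⟨T, hT, h1, h2⟩ := happ n hn f hf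
    have hTX : T ∈ X.carrier := PeriodicBanachLattice.trig_mem hT
    have hfT := X.carrier.sub_mem hf hTX
    set a := X.norm (steklovDotDiff (γ / n) s f)
    set b := G.discNorm n (steklovDiff (γ / n) r f)
    have ha0 : 0 ≤ a := X.norm_nonneg _ (PeriodicBanachLattice.steklovDotDiff_bound hM hh s hf).1
    have hb0 : 0 ≤ b := G.discNorm_nonneg _ _
    have hCab : C * a ≤ C * (a + b) := by gcongr; linarith
    have hd : G.discNorm n (f - T) ≤ D * (a + b) := by
      -- Samples of `f` enter only through `(I - A_h)^r f`; the other pieces are a polynomial and a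
      -- sum of averages.
      have e : f - T = (steklovDiff (γ / n) r f - steklovDiff (γ / n) r T) +
          ((f - T) - steklovDiff (γ / n) r (f - T)) := by
        rw [PeriodicBanachLattice.steklovDiff_sub hM hh r hf hTX]
        abel
      rw [e]
      refine (G.discNorm_add_le _ _ _).trans ?_
      have c1 := G.discNorm_sub_le n (steklovDiff (γ / n) r f) (steklovDiff (γ / n) r T)
      have c2 := SamplingScheme.discNorm_sub_steklovDiff_le (G := G) hγ hδ hM hn hfT r
      have c3 := SamplingScheme.discNorm_steklovDiff_trig_le (G := G) hγ hδ hM hn hT hrs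
      have c4 : A * X.norm (f - T) ≤ A * (C * (a + b)) := by gcongr; exact h1.trans hCab
      have c5 := mul_le_mul_of_nonneg_left (h2.trans hCab) hB0
      have c6 : D * (a + b) = (a + b) + B * (C * (a + b)) + A * (C * (a + b)) := by
        rw [hD]; ring
      linarith
    refine ⟨T, hT, h1.trans hCab, hd, ?_⟩
    have hopT := SamplingScheme.op_mem (G := G) hn T
    have hopf := SamplingScheme.op_mem (G := G) hn f
    have e : f - G.op n f = (f - T) + (T - G.op n T) - G.op n (f - T) := by
      rw [SamplingScheme.op_sub]
      abel
    rw [e]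
    refine (PeriodicBanachLattice.norm_sub_le
      (X.carrier.add_mem hfT (X.carrier.sub_mem hTX hopT))
      (SamplingScheme.op_mem hn _)).trans ?_
    have c1 := X.norm_add_le _ hfT _ (X.carrier.sub_mem hTX hopT)
    have c2 := hjack n hn T hT
    have c3 := hstab n hn _ hfT
    have c4 := mul_le_mul_of_nonneg_left hd hK₁.le
    have c5 := mul_le_mul_of_nonneg_left (h2.trans hCab) hK₃.le
    have c6 : E * (a + b) = C * (a + b) + K₃ * (C * (a + b)) + K₁ * (D * (a + b)) := by
      rw [hE]; ring
    linarith [h1.trans hCab]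
  refine ⟨E + D + P * (C + E) + 1, by positivity, fun G hstab hjack => ⟨?_, ?_⟩⟩
  · intro n hn f hf
    obtain ⟨-, -, -, -, h⟩ := key G hstab hjack n hn f hf
    have hh : 0 < γ / n := div_pos hγ (by exact_mod_cast hn)
    have ha0 := X.norm_nonneg _ (PeriodicBanachLattice.steklovDotDiff_bound hM hh s hf).1
    have hb0 := G.discNorm_nonneg n (steklovDiff (γ / n) r f)
    refine h.trans ?_
    gcongr
    have : 0 ≤ P * (C + E) := by positivity
    linarith
  · intro hpoly n hn f hf
    obtain ⟨T, hT, h1, h2, h3⟩ := key G hstab hjack n hn f hf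
    have hh : 0 < γ / n := div_pos hγ (by exact_mod_cast hn)
    set a := X.norm (steklovDotDiff (γ / n) s f)
    set b := G.discNorm n (steklovDiff (γ / n) r f)
    have ha0 : 0 ≤ a := X.norm_nonneg _ (PeriodicBanachLattice.steklovDotDiff_bound hM hh s hf).1
    have hb0 : 0 ≤ b := G.discNorm_nonneg _ _
    have hG : G.op n f ∈ trigSubmodule n := hpoly n hn f hf
    have hTX : T ∈ X.carrier := PeriodicBanachLattice.trig_mem hT
    have hopf := SamplingScheme.op_mem (G := G) hn f
    have e : f - G.op n f = (f - T) + (T - G.op n f) := by abel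
    have e' : T - G.op n f = (f - G.op n f) - (f - T) := by abel
    -- Here the additional hypothesis is used: `T - G_n f` is a polynomial of degree at most `n`, so
    -- its samples are controlled by its norm, and the first estimate applies.
    have c1 := SamplingScheme.discNorm_trig_le (G := G) hγ hδ hM hn (Submodule.sub_mem _ hT hG)
    have c2 : X.norm (T - G.op n f) ≤ (C + E) * (a + b) := by
      rw [e']
      refine (PeriodicBanachLattice.norm_sub_le (X.carrier.sub_mem hf hopf)
        (X.carrier.sub_mem hf hTX)).trans ?_
      linarith
    have c3 := mul_le_mul_of_nonneg_left c2 hP0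
    have c4 : 0 ≤ E * (a + b) := by positivity
    rw [e]
    refine (G.discNorm_add_le _ _ _).trans ?_
    have c5 : (E + D + P * (C + E) + 1) * (a + b) =
        E * (a + b) + D * (a + b) + P * ((C + E) * (a + b)) + (a + b) := by ring
    linarith
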